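/- Let $M$ be a compact oriented 3-manifold with an oriented (concrete) ideal triangulation $\mathcal T$: finitely many copies $\Delta$ of the standard ordered 3-simplex with vertices $0,1,2,3$, all carrying the orientation of $M$, whose faces are glued in pairs by orientation-reversing affine maps; $\partial M$ is tiled by the cut-off triangles near the vertices. Let $n\ge 0$ be an integer (the result is of interest for $n\ge 2$). **Subsimplices and shape parameters.** Put $\Delta^3_m(\mathbb Z)=\{t\in\mathbb Z_{\ge0}^4: t_0+t_1+t_2+t_3=m\}$ and let $v_0,\dots,v_3$ be the standard basis of $\mathbb Z^4$. The edge $\varepsilon_{ij}$ of a simplex is identified with $v_i+v_j$. A subsimplex is a pair $(s,\Delta)$ with $s\in\Delta^3_{n-2}(\mathbb Z)$ (there is none if $n<2$), and the midpoint of its edge $e$ is $s+e\in\Delta^3_n(\mathbb Z)$. With $z=z_{s,\Delta}\in\mathbb C\setminus\{0,1\}$, its edges carry the shape parameters $z^{\varepsilon_{01}}=z^{\varepsilon_{23}}=z$, $z^{\varepsilon_{12}}=z^{\varepsilon_{03}}=\frac1{1-z}$, $z^{\varepsilon_{02}}=z^{\varepsilon_{13}}=1-\frac1z$. **Gluing equations.**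 An integral point $p$ of $\mathcal T$ is a class of pairs $(t,\Delta)$, $t\in\Delta^3_n(\mathbb Z)$, identified by the face pairings. For each non-vertex integral point $p$ the gluing equation $\prod_{(t,\Delta)\in p}\prod_{s+e=t}z^e_{s,\Delta}=1$ is written as $\prod z_{s,\Delta}^{A_{p,(s,\Delta)}}\prod(1-z_{s,\Delta})^{B_{p,(s,\Delta)}}=\pm1$. This defines the rows of $(A|B)$; the columns of $A$ and of $B$ are indexed by the subsimplices. **Boundary.** Use the doubly truncated cell decomposition of $\partial M$, with vertices $v^{ijk}_\Delta$ (near vertex $i$, edge $ij$, face $ijk$ of $\Delta$), oriented edges $\gamma^{ijk}_\Delta$ from $v^{ijk}_\Delta$ to $v^{ijl}_\Delta$ and $\beta^{ijk}_\Delta$ from $v^{ijk}_\Delta$ to $v^{ikj}_\Delta$, hexagonal faces, and polygonal faces around the ends of the edges of $\mathcal T$; here $\{i,j,k,l\}=\{0,1,2,3\}$. Let $\epsilon^{ijk}$ be the sign of the permutation $ijkl$ of $0123$. Let $\iota$ be the intersection form on $H_1(\partial M;\mathbb Z)$, where $\partial M$ is oriented counter-clockwise as seen from the ideal points, and a transverse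 crossing counts $+1$ if the tangent vectors (first curve, second curve) form a positive basis. **Cusp equations.** Let $e_1,\dots,e_{n-1}$ be the standard basis of $\mathbb Z^{n-1}$. For a class $\alpha\in H_1(\partial M)$, a representing cycle $a$ (written as a combination of the edges $\gamma^{ijk}_\Delta,\beta^{ijk}_\Delta$) and $1\le r\le n-1$, the cusp equation of $\alpha\otimes e_r$ says that the following product equals $1$: $\gamma^{ijk}_\Delta$ contributes $(z^{\varepsilon_{ij}}_{(r-1)v_i+(n-r-1)v_j,\Delta})^{-\epsilon^{ijk}}$, and $\beta^{ijk}_\Delta$ contributes $\prod_t X_t^{\epsilon^{ijk}}$ over the interior integral points $t$ of the face $ijk$ of $\Delta$ with $t_i=r$, where $X_t=-\prod_{s+e=t}z^e_{s,\Delta}$. Written as $\prod z_{s,\Delta}^{A^{\mathrm{cusp}}}\prod(1-z_{s,\Delta})^{B^{\mathrm{cusp}}}=\pm1$, it gives the row of $(A^{\mathrm{cusp}}|B^{\mathrm{cusp}})$ of $\alpha\otimes e_r$ (for the chosen $a$). **The form $\Omega$ and the elements $\delta'$.** Let $J^{\mathfrak g}(\mathcal T)$ be the abelian group generated by the edges $(s,e)_\Delta$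 of all subsimplices, modulo the equality of opposite edges of a subsimplex and $(s,\varepsilon_{01})_\Delta+(s,\varepsilon_{12})_\Delta+(s,\varepsilon_{02})_\Delta=0$. Let $\Omega$ be the skew-symmetric form on it for which different subsimplices are orthogonal and $\Omega(\varepsilon_{01},\varepsilon_{12})=\Omega(\varepsilon_{12},\varepsilon_{02})=\Omega(\varepsilon_{02},\varepsilon_{01})=1$ in each subsimplex. Let $\delta'(a\otimes e_r)\in J^{\mathfrak g}(\mathcal T)$ be the sum of all edges $(s,e)_\Delta$, each with coefficient the exponent with which $z^e_{s,\Delta}$ enters the cusp equation of $\alpha\otimes e_r$ for $a$. **Statement.** Let $\omega_J(x,y)=x^TJy$ with $J=\begin{pmatrix}0&I\\-I&0\end{pmatrix}$, and let $A_{\mathfrak g}$ be the Cartan matrix of $\mathfrak g=\mathfrak{sl}_n$. Then: 1. $\omega_J(x,y)=0$ for all rows $x,y$ of $(A|B)$. 2. $\omega_J(x,y)=0$ for every row $x$ of $(A|B)$ and every row $y$ of $(A^{\mathrm{cusp}}|B^{\mathrm{cusp}})$. 3. If $x,y$ are the rows of $(A^{\mathrm{cusp}}|B^{\mathrm{cusp}})$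 for $\alpha\otimes e_r$ and $\beta\otimes e_s$, read off from any representing cycles $a$ of $\alpha$ and $b$ of $\beta$, then $$-\omega_J(x,y)=\Omega\big(\delta'(a\otimes e_r),\delta'(b\otimes e_s)\big)=\iota(\alpha,\beta)\,\langle e_r,A_{\mathfrak g}e_s\rangle .$$ -/

import Mathlib

open scoped Matrix

set_option linter.unusedSectionVars false

noncomputable section

/-! ## Oriented ideal triangulations -/

/-- An oriented (concrete, topologically ideal) triangulation with set of simplices `T`: every
simplex is a standard ordered 3-simplex with vertices `0, 1, 2, 3`, and the faces are glued in
pairs.  The face of `Δ` opposite to vertex `l` is glued to a face of `nbr Δ l`.  The affine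
identification is recorded by the permutation `gluing Δ l`: it sends each vertex `i ≠ l` of the
face to the vertex it is identified with, and sends `l` to the vertex opposite to the target face.
All simplices carry the orientation of the manifold, so face pairings reverse orientation, i.e.
these permutations are odd. -/
structure OrientedTriangulation (T : Type*) where
  nbr : T → Fin 4 → T
  gluing : T → Fin 4 → Equiv.Perm (Fin 4)
  nbr_nbr : ∀ Δ l, nbr (nbr Δ l) (gluing Δ l l) = Δ
  gluing_gluing : ∀ Δ l, gluing (nbr Δ l) (gluing Δ l l) = (gluing Δ l)⁻¹
  sign_gluing : ∀ Δ l, Equiv.Perm.sign (gluing Δ l) = -1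
  no_self_gluing : ∀ Δ l, ¬ (nbr Δ l = Δ ∧ gluing Δ l l = l)

/-! ## Edges of a simplex, shape parameters, and the group `J_Δ` -/

/-- The six unoriented edges of the 3-simplex. -/
abbrev Edge : Type := {e : Sym2 (Fin 4) // ¬ e.IsDiag}

/-- The edge `ε_{ij}`. -/
def Edge.mk (i j : Fin 4) (h : i ≠ j) : Edge := ⟨s(i, j), by simpa using h⟩

/-- The edge as an integral point of the simplex `{x₀ + x₁ + x₂ + x₃ = 2}`,
e.g. `ε₀₁ = (1,1,0,0)`. -/
def Edge.vec (e : Edge) : Fin 4 → ℕ := fun m => if m ∈ e.1 then 1 else 0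

theorem Edge.sum_vec (e : Edge) : ∑ i, e.vec i = 2 := by
  revert e; decide

/-- A function of the edges that is equal on opposite edges: `x` on `ε₀₁, ε₂₃`, `y` on
`ε₁₂, ε₀₃` and `w` on `ε₀₂, ε₁₃`. -/
def Edge.byType {X : Type*} (x y w : X) (e : Edge) : X :=
  if e.1 = s(0, 1) ∨ e.1 = s(2, 3) then x
  else if e.1 = s(1, 2) ∨ e.1 = s(0, 3) then y
  else w

/-- The shape parameters assigned to the edges of an (ordered) simplex with parameter `z`. -/
def shapeParameter (z : ℂ) : Edge → ℂ := Edge.byType z (1 / (1 - z)) (1 - 1 / z)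

/-- Exponent of `z` in the shape parameter of an edge. -/
def expA : Edge → ℤ := Edge.byType 1 0 (-1)

/-- Exponent of `1 - z` in the shape parameter of an edge. -/
def expB : Edge → ℤ := Edge.byType 0 (-1) 1

/-- Every shape parameter is, up to sign, `z ^ expA * (1 - z) ^ expB`. -/
theorem shapeParameter_eq (z : ℂ) (h0 : z ≠ 0) (h1 : z ≠ 1) (e : Edge) :
    shapeParameter z e = Edge.byType 1 1 (-1) e * (z ^ expA e * (1 - z) ^ expB e) := by
  have h2 : (1 : ℂ) - z ≠ 0 := sub_ne_zero.mpr (Ne.symm h1)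
  unfold shapeParameter expA expB Edge.byType
  split_ifs
  · simp
  · simp
  · rw [zpow_neg_one, zpow_one]; field_simp; ring

/-- The relations in `J_Δ`: opposite edges are equal and `ε₀₁ + ε₁₂ + ε₀₂ = 0`. -/
def edgeRelations : Submodule ℤ (Edge → ℤ) :=
  Submodule.span ℤ
    { Pi.single (Edge.mk 0 1 (by decide)) 1 - Pi.single (Edge.mk 2 3 (by decide)) 1,
      Pi.single (Edge.mk 1 2 (by decide)) 1 - Pi.single (Edge.mk 0 3 (by decide)) 1,
      Pi.single (Edge.mk 0 2 (by decide)) 1 - Pi.single (Edge.mk 1 3 (by decide)) 1,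
      Pi.single (Edge.mk 0 1 (by decide)) 1 + Pi.single (Edge.mk 1 2 (by decide)) 1
        + Pi.single (Edge.mk 0 2 (by decide)) 1 }

/-- `J_Δ`: the free abelian group on the unoriented edges of a simplex modulo `edgeRelations`. -/
abbrev JSimplex : Type := (Edge → ℤ) ⧸ edgeRelations

/-- The class of an edge in `J_Δ`. -/
def JSimplex.of (e : Edge) : JSimplex := edgeRelations.mkQ (Pi.single e 1)

/-- Coordinates on `J_Δ` with respect to its basis `ε₀₁, ε₁₂`. -/
def JSimplex.coord : JSimplex →ₗ[ℤ] ℤ × ℤ :=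
  edgeRelations.liftQ
    (∑ e : Edge, (LinearMap.toSpanSingleton ℤ (ℤ × ℤ)
      (Edge.byType (1, 0) (0, 1) (-1, -1) e)).comp (LinearMap.proj e))
    (by
      unfold edgeRelations
      rw [Submodule.span_le]
      rintro x (rfl | rfl | rfl | rfl) <;>
        (simp only [SetLike.mem_coe, LinearMap.mem_ker, LinearMap.sum_apply, LinearMap.comp_apply,
          LinearMap.proj_apply, LinearMap.toSpanSingleton_apply]; decide))

/-- The skew-symmetric form `Ω` on `J_Δ`. -/
def JSimplex.Omega (x y : JSimplex) : ℤ :=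
  (JSimplex.coord x).1 * (JSimplex.coord y).2 - (JSimplex.coord x).2 * (JSimplex.coord y).1

theorem JSimplex.coord_of (e : Edge) :
    JSimplex.coord (JSimplex.of e) = Edge.byType (1, 0) (0, 1) (-1, -1) e := by
  simp [JSimplex.coord, JSimplex.of, Submodule.mkQ_apply, Submodule.liftQ_apply, Pi.single_apply]

theorem JSimplex.Omega_basis :
    JSimplex.Omega (.of (Edge.mk 0 1 (by decide))) (.of (Edge.mk 1 2 (by decide))) = 1 ∧
    JSimplex.Omega (.of (Edge.mk 1 2 (by decide))) (.of (Edge.mk 0 2 (by decide))) = 1 ∧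
    JSimplex.Omega (.of (Edge.mk 0 2 (by decide))) (.of (Edge.mk 0 1 (by decide))) = 1 := by
  simp only [JSimplex.Omega, JSimplex.coord_of]
  decide

/-! ## Integral points, subsimplices, and the gluing equation matrix -/

/-- Integral points of the simplices of the triangulation, before identification. -/
abbrev LocalPoint (T : Type*) (n : ℕ) : Type _ := T × {t : Fin 4 → ℕ // ∑ i, t i = n}

/-- The subsimplices `(s, Δ)`, `s ∈ Δ³_{n-2}(ℤ)`, of the simplices of the triangulation. -/
abbrev Subsimplex (T : Type*) (n : ℕ) : Type _ := T × {s : Fin 4 → ℕ // ∑ i, s i + 2 = n}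

instance (n : ℕ) : Fintype {s : Fin 4 → ℕ // ∑ i, s i + 2 = n} :=
  Fintype.subtype ((Finset.piAntidiag Finset.univ (n - 2)).filter (fun s => ∑ i, s i + 2 = n))
    (by
      intro s
      simp only [Finset.mem_filter, Finset.mem_piAntidiag, Finset.mem_univ, implies_true, and_true]
      refine ⟨fun h => h.2, fun h => ⟨?_, h⟩⟩
      have h' : Finset.univ.sum s + 2 = n := h
      omega)

/-- The midpoint `s + e` of the edge `e` of the subsimplex `(s, Δ)`. -/
def Subsimplex.midpoint {T : Type*} {n : ℕ} (c : Subsimplex T n) (e : Edge) : LocalPoint T n :=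
  (c.1, ⟨c.2.1 + e.vec, by
    have h1 := c.2.2
    have h2 := e.sum_vec
    simp only [Pi.add_apply, Finset.sum_add_distrib]
    omega⟩)

namespace OrientedTriangulation

variable {T : Type*} (𝒯 : OrientedTriangulation T)

/-- Two integral points of simplices correspond under a face pairing. -/
def FacePaired {n : ℕ} (x y : LocalPoint T n) : Prop :=
  ∃ l, x.2.1 l = 0 ∧ y.1 = 𝒯.nbr x.1 l ∧ ∀ i, y.2.1 (𝒯.gluing x.1 l i) = x.2.1 i

/-- Integral points of the triangulation. -/
def IntegralPoint (n : ℕ) : Type _ := Quot (𝒯.FacePaired (n := n))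

/-- Integral points that are not vertex points. -/
def NonVertexPoint (n : ℕ) : Type _ :=
  {p : 𝒯.IntegralPoint n // ∀ x, Quot.mk _ x = p → ∀ i, x.2.1 i ≠ n}

open Classical in
/-- For each subsimplex, the sum of `w e` over its edges `e` whose midpoint is the point `p`. -/
def gluingSum {M : Type*} [AddCommGroup M] (w : Edge → M) {n : ℕ} (p : 𝒯.NonVertexPoint n)
    (c : Subsimplex T n) : M :=
  ∑ e : Edge, if Quot.mk _ (c.midpoint e) = p.1 then w e else 0

/-- The gluing equation matrix `(A | B)`: the gluing equation of `p`, which sets the product of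
the shape parameters of all edges of subsimplices with midpoint `p` equal to `1`, reads
`∏ z ^ A * ∏ (1 - z) ^ B = ± 1`. -/
def gluingMatrix (n : ℕ) : Matrix (𝒯.NonVertexPoint n) (Subsimplex T n ⊕ Subsimplex T n) ℤ :=
  Matrix.fromCols (Matrix.of (𝒯.gluingSum expA)) (Matrix.of (𝒯.gluingSum expB))

end OrientedTriangulation

/-! ## The doubly truncated decomposition of the boundary -/

/-- A flag `(Δ, σ)`, `σ = (i, j, k, l)`, stands for the superscript `ijk` in `v^{ijk}_Δ`,
`γ^{ijk}_Δ`, `β^{ijk}_Δ`: `i` is the nearest vertex, `ij` the nearest edge and `ijk` the nearest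
face. -/
abbrev BdFlag (T : Type*) : Type _ := T × Equiv.Perm (Fin 4)

/-- The sign `ε^{ijk}` of the permutation `ijkl`. -/
def BdFlag.sgn {T : Type*} (f : BdFlag T) : ℤ := Equiv.Perm.sign f.2

/-- `ijk ↦ ijl`; the edge `γ^{ijk}` runs from `v^{ijk}` to `v^{ijl}`. -/
def BdFlag.kap {T : Type*} (f : BdFlag T) : BdFlag T := (f.1, f.2 * Equiv.swap 2 3)

/-- `ijk ↦ ikj`; the edge `β^{ijk}` runs from `v^{ijk}` to `v^{ikj}`. -/
def BdFlag.mu {T : Type*} (f : BdFlag T) : BdFlag T := (f.1, f.2 * Equiv.swap 1 2)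

/-- Formal integral combinations of the oriented edges `γ^{ijk}_Δ` (first component) and
`β^{ijk}_Δ` (second component) of the decompositions of the cut-off triangles of the individual
simplices. -/
abbrev LocalChain (T : Type*) : Type _ := (BdFlag T → ℤ) × (BdFlag T → ℤ)

namespace OrientedTriangulation

variable {T : Type*} [Fintype T] [DecidableEq T] (𝒯 : OrientedTriangulation T)

/-- The flag in the neighboring simplex that corresponds to `ijk` under the pairing of the face
`ijk`. -/
def cross (f : BdFlag T) : BdFlag T :=
  (𝒯.nbr f.1 (f.2 3), 𝒯.gluing f.1 (f.2 3) * f.2)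

/-- The edge `γ^f_Δ`. -/
def gam (f : BdFlag T) : LocalChain T := (Pi.single f 1, 0)

/-- The edge `β^f_Δ`. -/
def bet (f : BdFlag T) : LocalChain T := (0, Pi.single f 1)

/-- The boundary of a formal combination of edges: the coefficient of `v^f_Δ`. -/
def localBoundary : LocalChain T →ₗ[ℤ] (BdFlag T → ℤ) where
  toFun a := fun f => (a.1 f.kap - a.1 f) + (a.2 f.mu - a.2 f)
  map_add' a b := by ext f; simp; ring
  map_smul' m a := by ext f; simp; ring

/-- The 0-chains of the decomposition are the combinations of the `v^f_Δ` modulo the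
identification of the vertices `v^f_Δ` by the face pairings. -/
def vertexRelations : Submodule ℤ (BdFlag T → ℤ) :=
  Submodule.span ℤ (Set.range fun f => Pi.single f 1 - Pi.single (𝒯.cross f) 1)

/-- The formal combinations of oriented edges representing a cellular 1-cycle of `∂M`. -/
def cycles : Submodule ℤ (LocalChain T) := 𝒯.vertexRelations.comap localBoundary

/-- Two flags belong to the same polygonal face. -/
def SamePolygon : BdFlag T → BdFlag T → Prop :=
  Relation.EqvGen fun f g => g = f.kap ∨ g = 𝒯.cross f

/-- The boundary of the hexagonal face `τ^i_Δ`. -/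
def hexagonBoundary (Δ : T) (i : Fin 4) : LocalChain T :=
  ∑ σ : Equiv.Perm (Fin 4), if σ 0 = i then
    (if Equiv.Perm.sign σ = -1 then gam (Δ, σ) else bet (Δ, σ)) else 0

open Classical in
/-- The boundary of the polygonal face containing the flag `f`. -/
def polygonBoundary (f : BdFlag T) : LocalChain T :=
  ∑ g : BdFlag T, if 𝒯.SamePolygon f g ∧ g.sgn = -1 then gam g else 0

/-- The formal combinations of oriented edges representing a cellular 1-boundary of `∂M`.  The
first three kinds of generators express that `γ^{ijl} = -γ^{ijk}` and `β^{ikj} = -β^{ijk}`, and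
that edges `β^{ijk}` are identified by the face pairings; the others are the boundaries of the
2-cells. -/
def boundaries : Submodule ℤ (LocalChain T) :=
  Submodule.span ℤ
    ((Set.range fun f : BdFlag T => gam f + gam f.kap) ∪
      (Set.range fun f : BdFlag T => bet f + bet f.mu) ∪
      (Set.range fun f : BdFlag T => bet f - bet (𝒯.cross f)) ∪
      (Set.range fun x : T × Fin 4 => hexagonBoundary x.1 x.2) ∪
      (Set.range fun f : BdFlag T => 𝒯.polygonBoundary f))

/-- The cellular homology group `H₁(∂M; ℤ)` of the doubly truncated decomposition of `∂M`. -/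
abbrev H1 : Type _ := 𝒯.cycles ⧸ 𝒯.boundaries.submoduleOf 𝒯.cycles

/-! ### The intersection form -/

/-- Signed number of intersections of `γ^{ijk}_Δ` with `β^{i'j'k'}_Δ`: collapsing the edges `β`
turns `γ^{ijk}` into the edge `-ε^{ijk} e^{ij}` of the polygonal decomposition (`e^{ij}` runs
counter-clockwise around the corner `ij`, seen from the ideal vertex `i`), collapsing the polygonal
faces turns `β^{i'j'k'}` into the edge `E^{i'j'k'}` of the triangulation of `∂M` that runs from the
corner `i'j'` to the corner `i'k'`, and `e^{ij}` meets `E^{i'j'k'}` with sign `1` if `i = i'`,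
`j = k'`, with sign `-1` if `i = i'`, `j = j'`, and not at all otherwise. -/
def crossing (σ τ : Equiv.Perm (Fin 4)) : ℤ :=
  -(Equiv.Perm.sign σ : ℤ) *
    (if σ 0 = τ 0 ∧ σ 1 = τ 2 then 1 else if σ 0 = τ 0 ∧ σ 1 = τ 1 then -1 else 0)

/-- The intersection pairing of formal combinations of edges. -/
def chainPairing : LocalChain T →ₗ[ℤ] LocalChain T →ₗ[ℤ] ℤ :=
  LinearMap.mk₂ ℤ
    (fun a b => ∑ Δ : T, ∑ σ : Equiv.Perm (Fin 4), ∑ τ : Equiv.Perm (Fin 4),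
      a.1 (Δ, σ) * b.2 (Δ, τ) * crossing σ τ)
    (by intros; simp [add_mul, Finset.sum_add_distrib])
    (by intros; simp [Finset.mul_sum, mul_assoc])
    (by intros; simp [add_mul, mul_add, Finset.sum_add_distrib])
    (by intros; simp [Finset.mul_sum, mul_assoc, mul_left_comm])

theorem sum_crossing_right (y : Equiv.Perm (Fin 4) → ℤ) (σ : Equiv.Perm (Fin 4)) :
    ∑ τ, y τ * crossing σ τ = -(Equiv.Perm.sign σ : ℤ) *
      (y (σ * Equiv.swap 1 2) + y (σ * Equiv.swap 2 3 * Equiv.swap 1 2)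
        - y σ - y (σ * Equiv.swap 2 3)) := by
  have key : ∀ ρ : Equiv.Perm (Fin 4),
      (if 0 = ρ 0 ∧ 1 = ρ 2 then (1 : ℤ) else if 0 = ρ 0 ∧ 1 = ρ 1 then -1 else 0)
        = (if Equiv.swap 1 2 = ρ then 1 else 0)
          + (if Equiv.swap 2 3 * Equiv.swap 1 2 = ρ then 1 else 0)
          - (if 1 = ρ then 1 else 0) - (if Equiv.swap 2 3 = ρ then 1 else 0) := by decide
  rw [← Equiv.sum_comp (Equiv.mulLeft σ)]
  simp only [crossing, Equiv.coe_mulLeft, Equiv.Perm.mul_apply, σ.injective.eq_iff, key]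
  simp only [mul_add, mul_sub, mul_ite, mul_one, mul_zero, Finset.sum_add_distrib,
    Finset.sum_sub_distrib, Finset.sum_ite_eq, Finset.mem_univ, if_true, mul_assoc]
  ring

theorem sum_crossing_left (y : Equiv.Perm (Fin 4) → ℤ) (τ : Equiv.Perm (Fin 4)) :
    ∑ σ, y σ * crossing σ τ = (Equiv.Perm.sign τ : ℤ) *
      (y (τ * Equiv.swap 1 2) - y (τ * Equiv.swap 1 2 * Equiv.swap 2 3)
        + y τ - y (τ * Equiv.swap 2 3)) := by
  have key : ∀ ρ : Equiv.Perm (Fin 4), (Equiv.Perm.sign ρ : ℤ) *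
      (if ρ 0 = 0 ∧ ρ 1 = 2 then (1 : ℤ) else if ρ 0 = 0 ∧ ρ 1 = 1 then -1 else 0)
        = - (if Equiv.swap 1 2 = ρ then 1 else 0)
          + (if Equiv.swap 1 2 * Equiv.swap 2 3 = ρ then 1 else 0)
          - (if 1 = ρ then 1 else 0) + (if Equiv.swap 2 3 = ρ then 1 else 0) := by decide
  rw [← Equiv.sum_comp (Equiv.mulLeft τ)]
  have h : ∀ ρ : Equiv.Perm (Fin 4), y (Equiv.mulLeft τ ρ) * crossing (Equiv.mulLeft τ ρ) τ
      = -(Equiv.Perm.sign τ : ℤ) * (y (τ * ρ) * ((Equiv.Perm.sign ρ : ℤ) *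
        (if ρ 0 = 0 ∧ ρ 1 = 2 then (1 : ℤ) else if ρ 0 = 0 ∧ ρ 1 = 1 then -1 else 0))) := by
    intro ρ
    simp only [crossing, Equiv.coe_mulLeft, Equiv.Perm.mul_apply, τ.injective.eq_iff,
      Equiv.Perm.sign_mul, Units.val_mul]
    ring
  simp only [h, key, ← Finset.mul_sum]
  simp only [mul_add, mul_sub, mul_neg, mul_ite, mul_one, mul_zero, Finset.sum_add_distrib,
    Finset.sum_sub_distrib, Finset.sum_neg_distrib, Finset.sum_ite_eq, Finset.mem_univ, if_true,
    ← mul_assoc]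
  ring

theorem chainPairing_apply (a b : LocalChain T) : chainPairing a b =
    ∑ f : BdFlag T, a.1 f * ∑ τ, b.2 (f.1, τ) * crossing f.2 τ := by
  rw [Fintype.sum_prod_type]
  simp [chainPairing, Finset.mul_sum, mul_assoc]

theorem chainPairing_apply_left (a b : LocalChain T) : chainPairing a b =
    ∑ g : BdFlag T, b.2 g * ∑ σ, a.1 (g.1, σ) * crossing σ g.2 := by
  rw [Fintype.sum_prod_type]
  simp only [chainPairing, Finset.mul_sum, LinearMap.mk₂_apply]
  refine Finset.sum_congr rfl fun Δ _ => ?_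
  rw [Finset.sum_comm]
  refine Finset.sum_congr rfl fun _ _ => Finset.sum_congr rfl fun _ _ => by ring

theorem kap_kap (f : BdFlag T) : f.kap.kap = f := by
  simp [BdFlag.kap, mul_assoc]

theorem mu_mu (f : BdFlag T) : f.mu.mu = f := by
  simp [BdFlag.mu, mul_assoc]

theorem sgn_kap (f : BdFlag T) : f.kap.sgn = -f.sgn := by
  simp [BdFlag.kap, BdFlag.sgn]

theorem sgn_mu (f : BdFlag T) : f.mu.sgn = -f.sgn := by
  simp [BdFlag.mu, BdFlag.sgn]

theorem sgn_cross (f : BdFlag T) : (𝒯.cross f).sgn = -f.sgn := by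
  simp [cross, BdFlag.sgn, 𝒯.sign_gluing]

theorem cross_cross (f : BdFlag T) : 𝒯.cross (𝒯.cross f) = f := by
  simp [cross, 𝒯.nbr_nbr, 𝒯.gluing_gluing]

theorem cross_mu (f : BdFlag T) : 𝒯.cross f.mu = (𝒯.cross f).mu := by
  have h : Equiv.swap (1 : Fin 4) 2 3 = 3 := by decide
  simp [cross, BdFlag.mu, mul_assoc, h]

theorem chainPairing_gam (f : BdFlag T) (b : LocalChain T) : chainPairing (gam f) b =
    -f.sgn * (b.2 f.mu + b.2 f.kap.mu - b.2 f - b.2 f.kap) := by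
  rw [chainPairing_apply, Finset.sum_eq_single f]
  · rw [sum_crossing_right]; simp [gam, BdFlag.sgn, BdFlag.mu, BdFlag.kap]
  · intro g _ h; simp [gam, h]
  · simp

theorem chainPairing_bet (a : LocalChain T) (g : BdFlag T) : chainPairing a (bet g) =
    g.sgn * (a.1 g.mu - a.1 g.mu.kap + a.1 g - a.1 g.kap) := by
  rw [chainPairing_apply_left, Finset.sum_eq_single g]
  · rw [sum_crossing_left]; simp [bet, BdFlag.sgn, BdFlag.mu, BdFlag.kap]
  · intro f _ h; simp [bet, h]
  · simp

theorem chainPairing_bet_left (f : BdFlag T) (b : LocalChain T) :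
    chainPairing (bet f) b = 0 := by
  rw [chainPairing_apply]; simp [bet]

theorem chainPairing_gam_right (a : LocalChain T) (f : BdFlag T) :
    chainPairing a (gam f) = 0 := by
  rw [chainPairing_apply]; simp [gam]

theorem boundary_add_cross {a : LocalChain T} (ha : a ∈ 𝒯.cycles) (f : BdFlag T) :
    localBoundary a f + localBoundary a (𝒯.cross f) = 0 := by
  have h : ∀ x ∈ 𝒯.vertexRelations, x f + x (𝒯.cross f) = 0 := by
    intro x hx
    refine Submodule.span_induction ?_ (by simp) ?_ ?_ hx
    · rintro _ ⟨g, rfl⟩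
      have e1 : f = g ↔ 𝒯.cross f = 𝒯.cross g :=
        ⟨fun h => by rw [h], fun h => by rw [← 𝒯.cross_cross f, h, 𝒯.cross_cross]⟩
      have e2 : 𝒯.cross f = g ↔ f = 𝒯.cross g :=
        ⟨fun h => by rw [← h, 𝒯.cross_cross], fun h => by rw [h, 𝒯.cross_cross]⟩
      simp only [Pi.sub_apply, Pi.single_apply, e2, ← e1]
      ring
    · intro x y _ _ hx hy
      simp only [Pi.add_apply]; linarith
    · intro c x _ hx
      simp only [Pi.smul_apply, ← smul_add, hx, smul_zero]
  exact h _ ha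

theorem samePolygon_cross (f g : BdFlag T) :
    𝒯.SamePolygon f (𝒯.cross g) ↔ 𝒯.SamePolygon f g := by
  have h : 𝒯.SamePolygon g (𝒯.cross g) := Relation.EqvGen.rel _ _ (Or.inr rfl)
  exact ⟨fun k => k.trans _ _ _ (h.symm _ _), fun k => k.trans _ _ _ h⟩

theorem samePolygon_kap (f g : BdFlag T) :
    𝒯.SamePolygon f g.kap ↔ 𝒯.SamePolygon f g := by
  have h : 𝒯.SamePolygon g g.kap := Relation.EqvGen.rel _ _ (Or.inl rfl)
  exact ⟨fun k => k.trans _ _ _ (h.symm _ _), fun k => k.trans _ _ _ h⟩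

open Classical in
theorem chainPairing_polygon (f : BdFlag T) {b : LocalChain T} (hb : b ∈ 𝒯.cycles) :
    chainPairing (𝒯.polygonBoundary f) b = 0 := by
  have kapE : Function.Involutive (BdFlag.kap (T := T)) := kap_kap
  have crE : Function.Involutive 𝒯.cross := 𝒯.cross_cross
  set S : (BdFlag T → ℤ) → ℤ := fun y => ∑ g, if 𝒯.SamePolygon f g then y g else 0 with hS
  have Skap : ∀ y, S (fun g => y g.kap) = S y := by
    intro y
    simp only [hS]
    rw [← Equiv.sum_comp kapE.toPerm]
    simp [samePolygon_kap, kap_kap]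
  have Scr : ∀ y, S (fun g => y (𝒯.cross g)) = S y := by
    intro y
    simp only [hS]
    rw [← Equiv.sum_comp crE.toPerm]
    simp [samePolygon_cross, cross_cross]
  have Sadd : ∀ y z, S (fun g => y g + z g) = S y + S z := by
    intro y z
    simp only [hS, ← Finset.sum_add_distrib]
    exact Finset.sum_congr rfl fun _ _ => by split_ifs <;> simp
  have Ssub : ∀ y z, S (fun g => y g - z g) = S y - S z := by
    intro y z
    simp only [hS, ← Finset.sum_sub_distrib]
    exact Finset.sum_congr rfl fun _ _ => by split_ifs <;> simp
  have hbd : S (localBoundary b) = 0 := by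
    have h1 : S (fun g => localBoundary b g + localBoundary b (𝒯.cross g)) =
        S (localBoundary b) + S (localBoundary b) := by rw [Sadd, Scr]
    have h2 : S (fun g => localBoundary b g + localBoundary b (𝒯.cross g)) = 0 := by
      simp only [𝒯.boundary_add_cross hb, hS]; simp
    linarith
  have hbd2 : S (localBoundary b) = S (fun g => b.2 g.mu) - S (fun g => b.2 g) := by
    have h1 : S (localBoundary b) =
      S (fun g => b.1 g.kap - b.1 g) + S (fun g => b.2 g.mu - b.2 g) := Sadd _ _
    have h2 : S (fun g => b.1 g.kap - b.1 g) = 0 := by rw [Ssub, Skap b.1]; exact sub_self _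
    rw [h1, h2, Ssub, zero_add]
  have hm : S (fun g => if g.sgn = -1 then
      (b.2 g.mu + b.2 g.kap.mu - b.2 g - b.2 g.kap) else 0) =
      S (fun g => b.2 g.mu) - S (fun g => b.2 g) := by
    have h1 := Skap (fun g => if g.sgn = -1 then (b.2 g.kap.mu - b.2 g.kap) else 0)
    have h2 := Sadd (fun g => if g.sgn = -1 then (b.2 g.kap.mu - b.2 g.kap) else 0)
      (fun g => if g.sgn = -1 then (b.2 g.mu - b.2 g) else 0)
    rw [← h1, ← Sadd] at h2
    rw [← Ssub]
    refine Eq.trans ?_ (h2.trans ?_)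
    · congr 1; ext g; beta_reduce; split_ifs <;> ring
    · congr 1; ext g
      rcases Int.units_eq_one_or (Equiv.Perm.sign g.2) with h | h
      · have : g.sgn = 1 := by simp [BdFlag.sgn, h]
        simp [sgn_kap, this, kap_kap]
      · have : g.sgn = -1 := by simp [BdFlag.sgn, h]
        simp [sgn_kap, this]
  rw [← hbd, hbd2, ← hm]
  simp only [polygonBoundary, map_sum, LinearMap.sum_apply, hS]
  refine Finset.sum_congr rfl fun g _ => ?_
  by_cases h1 : 𝒯.SamePolygon f g
  · by_cases h2 : g.sgn = -1
    · simp [h1, h2, chainPairing_gam]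
    · simp [h1, h2]
  · simp [h1]

theorem sum_hexagon_swap (i : Fin 4) (u : ℤˣ) (y : Equiv.Perm (Fin 4) → ℤ)
    (κ : Equiv.Perm (Fin 4)) (h0 : κ 0 = 0) (h1 : Equiv.Perm.sign κ = -1) :
    ∑ σ : Equiv.Perm (Fin 4), (if σ 0 = i ∧ Equiv.Perm.sign σ = u then y (σ * κ) else 0) =
      ∑ σ : Equiv.Perm (Fin 4), if σ 0 = i ∧ Equiv.Perm.sign σ = -u then y σ else 0 := by
  rw [← Equiv.sum_comp (Equiv.mulRight κ)
    (fun σ => if σ 0 = i ∧ Equiv.Perm.sign σ = -u then y σ else 0)]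
  simp [h0, h1]

theorem chainPairing_hexagon_left (Δ : T) (i : Fin 4) (b : LocalChain T) :
    chainPairing (hexagonBoundary Δ i) b = 0 := by
  have h : ∀ σ : Equiv.Perm (Fin 4), chainPairing (if σ 0 = i then
      (if Equiv.Perm.sign σ = -1 then gam (Δ, σ) else bet (Δ, σ)) else 0) b =
      (if σ 0 = i ∧ Equiv.Perm.sign σ = -1 then b.2 (Δ, σ * Equiv.swap 1 2) else 0)
      + (if σ 0 = i ∧ Equiv.Perm.sign σ = -1 then
          b.2 (Δ, σ * Equiv.swap 2 3 * Equiv.swap 1 2) else 0)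
      - (if σ 0 = i ∧ Equiv.Perm.sign σ = -1 then b.2 (Δ, σ) else 0)
      - (if σ 0 = i ∧ Equiv.Perm.sign σ = -1 then b.2 (Δ, σ * Equiv.swap 2 3) else 0) := by
    intro σ
    by_cases h1 : σ 0 = i <;> by_cases h2 : Equiv.Perm.sign σ = -1 <;>
      simp [h1, h2, chainPairing_gam, chainPairing_bet_left, BdFlag.sgn, BdFlag.mu, BdFlag.kap]
  simp only [hexagonBoundary, map_sum, LinearMap.sum_apply, h, Finset.sum_add_distrib,
    Finset.sum_sub_distrib]
  rw [sum_hexagon_swap i (-1) (fun σ => b.2 (Δ, σ)) _ (by decide) (by decide),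
    sum_hexagon_swap i (-1) (fun σ => b.2 (Δ, σ)) (Equiv.swap 2 3) (by decide) (by decide),
    sum_hexagon_swap i (-1) (fun σ => b.2 (Δ, σ * Equiv.swap 1 2)) _ (by decide) (by decide),
    sum_hexagon_swap i (- -1) (fun σ => b.2 (Δ, σ)) _ (by decide) (by decide)]
  simp

theorem chainPairing_hexagon_right (Δ : T) (i : Fin 4) (a : LocalChain T) :
    chainPairing a (hexagonBoundary Δ i) = 0 := by
  have h : ∀ σ : Equiv.Perm (Fin 4), chainPairing a (if σ 0 = i then
      (if Equiv.Perm.sign σ = -1 then gam (Δ, σ) else bet (Δ, σ)) else 0) =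
      (if σ 0 = i ∧ Equiv.Perm.sign σ = 1 then a.1 (Δ, σ * Equiv.swap 1 2) else 0)
      - (if σ 0 = i ∧ Equiv.Perm.sign σ = 1 then
          a.1 (Δ, σ * Equiv.swap 1 2 * Equiv.swap 2 3) else 0)
      + (if σ 0 = i ∧ Equiv.Perm.sign σ = 1 then a.1 (Δ, σ) else 0)
      - (if σ 0 = i ∧ Equiv.Perm.sign σ = 1 then a.1 (Δ, σ * Equiv.swap 2 3) else 0) := by
    intro σ
    rcases Int.units_eq_one_or (Equiv.Perm.sign σ) with h2 | h2 <;> by_cases h1 : σ 0 = i <;>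
      simp [h1, h2, chainPairing_gam_right, chainPairing_bet, BdFlag.sgn, BdFlag.mu, BdFlag.kap]
  simp only [hexagonBoundary, map_sum, h, Finset.sum_add_distrib, Finset.sum_sub_distrib]
  rw [sum_hexagon_swap i 1 (fun σ => a.1 (Δ, σ)) _ (by decide) (by decide),
    sum_hexagon_swap i 1 (fun σ => a.1 (Δ, σ)) (Equiv.swap 2 3) (by decide) (by decide),
    sum_hexagon_swap i 1 (fun σ => a.1 (Δ, σ * Equiv.swap 2 3)) _ (by decide) (by decide),
    sum_hexagon_swap i (-1) (fun σ => a.1 (Δ, σ)) _ (by decide) (by decide)]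
  simp

theorem chainPairing_boundary_left {x b : LocalChain T} (hx : x ∈ 𝒯.boundaries)
    (hb : b ∈ 𝒯.cycles) : chainPairing x b = 0 := by
  suffices h : 𝒯.boundaries ≤ LinearMap.ker (chainPairing.flip b) by exact h hx
  unfold boundaries
  rw [Submodule.span_le]
  rintro _ ((((⟨f, rfl⟩ | ⟨f, rfl⟩) | ⟨f, rfl⟩) | ⟨f, rfl⟩) | ⟨f, rfl⟩) <;>
    simp only [SetLike.mem_coe, LinearMap.mem_ker, LinearMap.flip_apply, map_add, map_sub,
      chainPairing_bet_left, chainPairing_hexagon_left,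
      𝒯.chainPairing_polygon _ hb, chainPairing_gam, kap_kap, sgn_kap]
  all_goals ring

theorem chainPairing_boundary_right {a x : LocalChain T} (ha : a ∈ 𝒯.cycles)
    (hx : x ∈ 𝒯.boundaries) : chainPairing a x = 0 := by
  suffices h : 𝒯.boundaries ≤ LinearMap.ker (chainPairing a) by exact h hx
  unfold boundaries
  rw [Submodule.span_le]
  rintro _ ((((⟨f, rfl⟩ | ⟨f, rfl⟩) | ⟨f, rfl⟩) | ⟨f, rfl⟩) | ⟨f, rfl⟩) <;>
    simp only [SetLike.mem_coe, LinearMap.mem_ker, map_add, map_sub, chainPairing_gam_right,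
      chainPairing_hexagon_right, chainPairing_bet, mu_mu, sgn_mu, sgn_cross]
  · ring
  · ring
  · have h1 := 𝒯.boundary_add_cross ha f
    have h2 := 𝒯.boundary_add_cross ha f.mu
    simp only [localBoundary, LinearMap.coe_mk, AddHom.coe_mk, mu_mu, cross_mu] at h1 h2
    linear_combination (-f.sgn) * (h1 + h2)
  · unfold polygonBoundary
    rw [map_sum]
    refine Finset.sum_eq_zero fun g _ => ?_
    split_ifs <;> simp [chainPairing_gam_right]

/-- The intersection form `ι` on `H₁(∂M)`. -/
def intersectionForm : 𝒯.H1 →ₗ[ℤ] 𝒯.H1 →ₗ[ℤ] ℤ :=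
  ((𝒯.boundaries.submoduleOf 𝒯.cycles).liftQ
    ((𝒯.boundaries.submoduleOf 𝒯.cycles).liftQ
      ((chainPairing.domRestrict 𝒯.cycles).compl₂ 𝒯.cycles.subtype) (by
        intro x hx
        ext b
        exact 𝒯.chainPairing_boundary_left hx b.2)).flip (by
    intro x hx
    rw [LinearMap.mem_ker]
    refine LinearMap.ext fun α => ?_
    obtain ⟨a, rfl⟩ := Submodule.mkQ_surjective _ α
    exact 𝒯.chainPairing_boundary_right a.2 hx)).flip

theorem intersectionForm_mk (a b : 𝒯.cycles) :
    𝒯.intersectionForm (Submodule.Quotient.mk a) (Submodule.Quotient.mk b) =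
      chainPairing a.1 b.1 := rfl

/-! ## The cusp equation matrix -/

open Classical in
/-- Linearization of the cusp equations: for the formal combination `a` of edges and `e_{r+1}`
(`r = 0, …, n - 2`) the component at a subsimplex of the sum in which
* `γ^{ijk}_Δ ⊗ e_{r+1}` contributes `-ε^{ijk}` times the edge `ε_{ij}` of the subsimplex
  `r v_i + (n - 2 - r) v_j` of `Δ`,
* `β^{ijk}_Δ ⊗ e_{r+1}` contributes `ε^{ijk}` times the sum, over the face points `t` of `Δ` on
  the face `ijk` with `t_i = r + 1`, of all edges `e` of subsimplices `s` with `s + e = t`,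

and every edge `e` is replaced by `w e`. -/
def cuspSum {M : Type*} [AddCommGroup M] (w : Edge → M) {n : ℕ} (a : LocalChain T)
    (r : Fin (n - 1)) (c : Subsimplex T n) : M :=
  ∑ σ : Equiv.Perm (Fin 4),
    ((-(Equiv.Perm.sign σ : ℤ) * a.1 (c.1, σ)) •
        (if c.2.1 = Pi.single (σ 0) r.1 + Pi.single (σ 1) (n - 2 - r.1)
          then w (Edge.mk (σ 0) (σ 1) (σ.injective.ne (by decide))) else 0)
      + ((Equiv.Perm.sign σ : ℤ) * a.2 (c.1, σ)) •
        ∑ e : Edge, if (c.midpoint e).2.1 (σ 3) = 0 ∧ (c.midpoint e).2.1 (σ 0) = r.1 + 1 ∧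
            (c.midpoint e).2.1 (σ 1) ≠ 0 ∧ (c.midpoint e).2.1 (σ 2) ≠ 0
          then w e else 0)

/-- The cusp equation matrix `(A^cusp | B^cusp)`: the row of `(a, r)`, where `a` represents a
class `α` in `H₁(∂M)`, holds the exponents in the cusp equation
`∏ z ^ A^cusp * ∏ (1 - z) ^ B^cusp = ± 1` for `α ⊗ e_{r+1}` which is read off from the
representative `a`. -/
def cuspMatrix (n : ℕ) :
    Matrix (𝒯.cycles × Fin (n - 1)) (Subsimplex T n ⊕ Subsimplex T n) ℤ :=
  Matrix.fromCols (Matrix.of fun x => cuspSum expA x.1.1 x.2)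
    (Matrix.of fun x => cuspSum expB x.1.1 x.2)

/-- The group `J^𝔤(𝒯)`: one copy of `J_Δ` for each subsimplex. -/
abbrev JGroup (T : Type*) (n : ℕ) : Type _ := Subsimplex T n → JSimplex

/-- The orthogonal extension of `Ω` to `J^𝔤(𝒯)`. -/
def JGroup.Omega {n : ℕ} (x y : JGroup T n) : ℤ := ∑ c, JSimplex.Omega (x c) (y c)

/-- The element `δ'(a ⊗ e_{r+1})` of `J^𝔤(𝒯)`. -/
def deltaPrime {n : ℕ} (a : LocalChain T) (r : Fin (n - 1)) : JGroup T n :=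
  cuspSum JSimplex.of a r

end OrientedTriangulation

/-- The standard symplectic form `ω_J(x, y) = xᵀ J y`, where `J` has the blocks
`0, I` and `-I, 0`. -/
def omegaJ {C : Type*} [Fintype C] [DecidableEq C] (x y : C ⊕ C → ℤ) : ℤ :=
  x ⬝ᵥ (Matrix.fromBlocks (0 : Matrix C C ℤ) 1 (-1) 0 *ᵥ y)

end

noncomputable section

/-! ## Rows as linear combinations indexed by integral points -/

/-! Every row comes from an integer weight on the integral points of the simplices: in each
subsimplex an edge counts with the weight of its midpoint (`gluingSum_eq_pointSum`,
`cuspSum_eq_pointSum`). Since `ω_J` is `-Ω` in the coordinates given by the exponents, all three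
claims concern the skew form `pointForm` of two weights.

Only pairs of edges sharing one vertex contribute, that is, pairs of points `u + v_j`, `u + v_k`.
Such a pair is seen from the two subsimplices `u - v_i` and `u - v_l`, with opposite signs. Hence it
cancels unless only one of them exists, in which case the pair lies in a face
(`sum_interior_eq_zero`, `pointForm_eq_facePairing`).

Face pairings reverse orientation, so what remains depends only on the jumps of the weights across
faces (`two_mul_facePairing`). Gluing weights have no jump, so gluing rows are orthogonal to each
other. The weight of a cycle does jump, but the cycle condition makes the jump of its
`β`-coefficients equal to minus that of its `γ`-coefficients, so one function `coeffJump` describes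
the jump at edge points and at interior face points alike (`faceValue_cuspFunction_sub_cross`).

Pairing any weight with such a jump cancels away from the edges and leaves a difference of two
consecutive edge sums (`facePairing_levelFamily`). These vanish for gluing weights
(`edgeSum_of_invariant`). For a cusp weight they produce `crossPairing`, which is twice the
intersection number (`two_mul_chainPairing`), together with a term pairing opposite ends of edges.
Antisymmetrizing, the opposite-end terms cancel and the consecutive levels combine to the entries
`2, -1, -1` of the Cartan matrix. -/

/-- For a function `φ` on the integral points of simplices, the sum of all edges of the
subsimplex `c`, each weighted by the value of `φ` at its midpoint, with every edge `e` replaced by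
`w e`. -/
def pointSum {T M : Type*} [AddCommGroup M] {n : ℕ} (w : Edge → M) (φ : T → (Fin 4 → ℕ) → ℤ)
    (c : Subsimplex T n) : M :=
  ∑ e : Edge, φ c.1 (c.2.1 + e.vec) • w e

/-- The form `Ω` evaluated on edges. -/
def edgeForm (e e' : Edge) : ℤ := expB e * expA e' - expA e * expB e'

/-- The form `Ω` evaluated on `pointSum φ` and `pointSum ψ`. -/
def pointForm {T : Type*} [Fintype T] (n : ℕ) (φ ψ : T → (Fin 4 → ℕ) → ℤ) : ℤ :=
  ∑ c : Subsimplex T n, (pointSum expB φ c * pointSum expA ψ c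
    - pointSum expA φ c * pointSum expB ψ c)

theorem omegaJ_fromCols {C : Type*} [Fintype C] [DecidableEq C] (a b a' b' : C → ℤ) :
    omegaJ (Sum.elim a b) (Sum.elim a' b') = ∑ c, (a c * b' c - b c * a' c) := by
  unfold omegaJ
  rw [Matrix.fromBlocks_mulVec]
  simp [dotProduct, Fintype.sum_sum_type, Matrix.neg_mulVec, Finset.sum_add_distrib,
    sub_eq_add_neg]

theorem omegaJ_pointSum {T : Type*} [Fintype T] [DecidableEq T] {n : ℕ}
    (φ ψ : T → (Fin 4 → ℕ) → ℤ) :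
    omegaJ (Sum.elim (pointSum (n := n) expA φ) (pointSum expB φ))
      (Sum.elim (pointSum expA ψ) (pointSum expB ψ)) = -pointForm n φ ψ := by
  rw [omegaJ_fromCols, pointForm, ← Finset.sum_neg_distrib]
  exact Finset.sum_congr rfl fun _ _ => by ring

/-- The minus sign on `expB` is what makes `Ω` equal to `-ω_J`. -/
theorem JSimplex.coord_of_eq (e : Edge) :
    JSimplex.coord (JSimplex.of e) = (expA e, -expB e) := by
  rw [JSimplex.coord_of]
  revert e; decide

theorem Omega_pointSum {T : Type*} [Fintype T] {n : ℕ} (φ ψ : T → (Fin 4 → ℕ) → ℤ) :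
    OrientedTriangulation.JGroup.Omega (n := n) (pointSum JSimplex.of φ)
      (pointSum JSimplex.of ψ) = pointForm n φ ψ := by
  have h : ∀ (χ : T → (Fin 4 → ℕ) → ℤ) (c : Subsimplex T n),
      JSimplex.coord (pointSum JSimplex.of χ c) = (pointSum expA χ c, -pointSum expB χ c) := by
    intro χ c
    simp only [pointSum, map_sum, map_smul, JSimplex.coord_of_eq, Prod.ext_iff, Prod.fst_sum,
      Prod.snd_sum, Prod.smul_mk, smul_neg, Finset.sum_neg_distrib, and_self]
  refine Finset.sum_congr rfl fun c _ => ?_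
  simp only [JSimplex.Omega, h]
  ring

/-! ## Reduction to the faces -/

/-- The edge `ε_{σ(0)σ(1)}`. -/
def firstEdge (σ : Equiv.Perm (Fin 4)) : Edge :=
  Edge.mk (σ 0) (σ 1) (σ.injective.ne (by decide))

/-- The edge `ε_{σ(0)σ(2)}`. -/
def secondEdge (σ : Equiv.Perm (Fin 4)) : Edge :=
  Edge.mk (σ 0) (σ 2) (σ.injective.ne (by decide))

/-- An ordered pair of edges with exactly one common vertex is `ε_{ij}, ε_{ik}` for a unique
permutation; equal and opposite edges pair to zero. -/
theorem edgeForm_eq : ∀ e e' : Edge, edgeForm e e' =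
    -∑ σ : Equiv.Perm (Fin 4), if e = firstEdge σ then
      (if e' = secondEdge σ then (Equiv.Perm.sign σ : ℤ) else 0) else 0 := by
  decide +kernel

theorem add_vec_comp (σ : Equiv.Perm (Fin 4)) (s : Fin 4 → ℕ) (i j : Fin 4) (h : i ≠ j) :
    s ∘ σ.symm + (Edge.mk (σ i) (σ j) (σ.injective.ne h)).vec =
      (s + (Edge.mk i j h).vec) ∘ σ.symm := by
  ext m
  simp [Edge.vec, Edge.mk, Equiv.symm_apply_eq]

/-- The integral points with coordinate sum `n - 2`. -/
abbrev SubsimplexIndex (n : ℕ) : Type := {s : Fin 4 → ℕ // ∑ i, s i + 2 = n}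

/-- The permutation of coordinates. -/
def SubsimplexIndex.permute {n : ℕ} (σ : Equiv.Perm (Fin 4)) :
    SubsimplexIndex n ≃ SubsimplexIndex n where
  toFun s := ⟨s.1 ∘ σ.symm, (congrArg (· + 2) (Equiv.sum_comp σ.symm s.1)).trans s.2⟩
  invFun s := ⟨s.1 ∘ σ, (congrArg (· + 2) (Equiv.sum_comp σ s.1)).trans s.2⟩
  left_inv s := by ext; simp
  right_inv s := by ext; simp

theorem sum_perm_eq_zero (H : Equiv.Perm (Fin 4) → ℤ) (κ : Equiv.Perm (Fin 4))
    (hκ : Equiv.Perm.sign κ = -1) (h : ∀ σ, H (σ * κ) = H σ) :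
    ∑ σ, (Equiv.Perm.sign σ : ℤ) * H σ = 0 := by
  have h1 := Equiv.sum_comp (Equiv.mulRight κ) fun σ => (Equiv.Perm.sign σ : ℤ) * H σ
  simp only [Equiv.coe_mulRight, Equiv.Perm.sign_mul, hκ, h, Units.val_neg, mul_neg,
    mul_one, neg_mul, Finset.sum_neg_distrib] at h1
  linarith

/-- Off the face opposite to `σ 3`, the same two points are also reached from the subsimplex one
step away in direction `v_0 - v_3` (in the coordinates of `σ`). There the roles of `σ 0` and `σ 3`
are exchanged, so the sign is opposite. -/
theorem sum_interior_eq_zero {n : ℕ} (φ ψ : (Fin 4 → ℕ) → ℤ) :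
    ∑ σ : Equiv.Perm (Fin 4), (Equiv.Perm.sign σ : ℤ) * ∑ s : SubsimplexIndex n,
      (if ¬ s.1 3 = 0 then
        φ ((s.1 + (firstEdge 1).vec) ∘ σ.symm) * ψ ((s.1 + (secondEdge 1).vec) ∘ σ.symm)
        else 0) = 0 := by
  refine sum_perm_eq_zero _ (Equiv.swap 0 3) (by decide) fun σ => ?_
  have hs : ∀ s : SubsimplexIndex n, ∑ i, ![s.1 3 - 1, s.1 1, s.1 2, s.1 0 + 1] i + 2 = n ∨
      s.1 3 = 0 := by
    intro s
    have := s.2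
    simp only [Fin.sum_univ_four] at this ⊢
    simp
    omega
  rw [← Finset.sum_filter, ← Finset.sum_filter]
  have e1 : (firstEdge 1).vec = ![1, 1, 0, 0] := by decide
  have e2 : (secondEdge 1).vec = ![1, 0, 1, 0] := by decide
  -- One unit moves from coordinate `3` to coordinate `0`, and then these two coordinates are
  -- exchanged; the result again has nonzero last coordinate.
  let i : ∀ s ∈ (Finset.univ.filter fun s : SubsimplexIndex n => ¬ s.1 3 = 0),
      SubsimplexIndex n := fun s h =>
    ⟨![s.1 3 - 1, s.1 1, s.1 2, s.1 0 + 1], (hs s).resolve_right (Finset.mem_filter.1 h).2⟩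
  refine Finset.sum_bij' i i ?_ ?_ ?_ ?_ ?_
  · intro s h; simp [i]
  · intro s h; simp [i]
  · intro s h
    have := (Finset.mem_filter.1 h).2
    ext m; fin_cases m <;> simp [i]; omega
  · intro s h
    have := (Finset.mem_filter.1 h).2
    ext m; fin_cases m <;> simp [i]; omega
  · intro s h
    have := (Finset.mem_filter.1 h).2
    have c : ∀ u v : Fin 4 → ℕ, u ∘ Equiv.swap 0 3 = v →
        u ∘ (σ * Equiv.swap 0 3).symm = v ∘ σ.symm := by
      rintro u _ rfl; ext m; simp [Equiv.Perm.mul_def]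
    congr 2
    · apply c
      rw [e1]
      ext m; fin_cases m <;> simp [i, Equiv.swap_apply_of_ne_of_ne]
      exacts [(Nat.sub_add_cancel (Nat.pos_of_ne_zero this)).symm, rfl, rfl, rfl]
    · apply c
      rw [e2]
      ext m; fin_cases m <;> simp [i, Equiv.swap_apply_of_ne_of_ne]
      exacts [(Nat.sub_add_cancel (Nat.pos_of_ne_zero this)).symm, rfl, rfl, rfl]

/-! ### Points of faces in triangular coordinates -/

/-- The triples of natural numbers with sum `n - 2`. -/
def triples (n : ℕ) : Finset (ℕ × ℕ × ℕ) :=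
  (Finset.range n ×ˢ Finset.range n ×ˢ Finset.range n).filter fun p => p.1 + p.2.1 + p.2.2 + 2 = n

theorem mem_triples {n : ℕ} {p : ℕ × ℕ × ℕ} : p ∈ triples n ↔ p.1 + p.2.1 + p.2.2 + 2 = n := by
  simp only [triples, Finset.mem_filter, Finset.mem_product, Finset.mem_range]
  omega

/-- The values of `φ` on the face `σ(0)σ(1)σ(2)` of a simplex in the coordinates of this face. -/
def faceValue {T : Type*} (φ : T → (Fin 4 → ℕ) → ℤ) (f : BdFlag T) (x y z : ℕ) : ℤ :=
  φ f.1 (![x, y, z, 0] ∘ f.2.symm)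

theorem sum_index_eq_sum_triples {n : ℕ} (F : (Fin 4 → ℕ) → ℤ) :
    ∑ s : SubsimplexIndex n, (if s.1 3 = 0 then F s.1 else 0) =
      ∑ p ∈ triples n, F ![p.1, p.2.1, p.2.2, 0] := by
  rw [← Finset.sum_filter]
  refine Finset.sum_bij' (fun s _ => (s.1 0, s.1 1, s.1 2))
    (fun p h => ⟨![p.1, p.2.1, p.2.2, 0], by
      have := mem_triples.1 h; simpa [Fin.sum_univ_four] using this⟩) ?_ ?_ ?_ ?_ ?_
  · intro s h
    have h1 := (Finset.mem_filter.1 h).2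
    have h2 := s.2
    rw [Fin.sum_univ_four] at h2
    rw [mem_triples]; dsimp only; omega
  · intro p h; simp
  · intro s h
    have h1 := (Finset.mem_filter.1 h).2
    ext m; fin_cases m <;> simp [h1]
  · intro p h; simp
  · intro s h
    have h1 := (Finset.mem_filter.1 h).2
    congr 1
    ext m; fin_cases m <;> simp [h1]

/-- The skew-symmetric pairing of two functions of the points of the faces. -/
def facePairing {T : Type*} [Fintype T] (n : ℕ) (Φ Ψ : BdFlag T → ℕ → ℕ → ℕ → ℤ) : ℤ :=
  ∑ f : BdFlag T, f.sgn * ∑ p ∈ triples n,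
    Φ f (p.1 + 1) (p.2.1 + 1) p.2.2 * Ψ f (p.1 + 1) p.2.1 (p.2.2 + 1)

theorem pointForm_eq_facePairing {T : Type*} [Fintype T] (n : ℕ) (φ ψ : T → (Fin 4 → ℕ) → ℤ) :
    pointForm n φ ψ = -facePairing n (faceValue φ) (faceValue ψ) := by
  unfold pointForm facePairing
  rw [Fintype.sum_prod_type, Fintype.sum_prod_type, ← Finset.sum_neg_distrib]
  refine Finset.sum_congr rfl fun Δ _ => ?_
  have h1 : ∀ s : SubsimplexIndex n,
      pointSum expB φ (Δ, s) * pointSum expA ψ (Δ, s)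
        - pointSum expA φ (Δ, s) * pointSum expB ψ (Δ, s) =
      -∑ σ : Equiv.Perm (Fin 4), (Equiv.Perm.sign σ : ℤ) *
        (φ Δ (s.1 + (firstEdge σ).vec) * ψ Δ (s.1 + (secondEdge σ).vec)) := by
    intro s
    have h2 : pointSum expB φ (Δ, s) * pointSum expA ψ (Δ, s)
        - pointSum expA φ (Δ, s) * pointSum expB ψ (Δ, s) =
        ∑ e : Edge, ∑ e' : Edge, φ Δ (s.1 + e.vec) * ψ Δ (s.1 + e'.vec) * edgeForm e e' := by
      simp only [pointSum, Finset.sum_mul_sum, ← Finset.sum_sub_distrib, edgeForm, smul_eq_mul]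
      exact Finset.sum_congr rfl fun _ _ => Finset.sum_congr rfl fun _ _ => by ring
    rw [h2]
    simp only [edgeForm_eq, mul_neg, Finset.sum_neg_distrib, Finset.mul_sum]
    congr 1
    rw [Finset.sum_congr rfl fun e _ => Finset.sum_comm, Finset.sum_comm]
    refine Finset.sum_congr rfl fun σ _ => ?_
    rw [Finset.sum_eq_single (firstEdge σ) (by intro e _ h; simp [h]) (by simp),
      Finset.sum_eq_single (secondEdge σ) (by intro e _ h; simp [h]) (by simp)]
    simp only [if_true]
    ring
  simp only [h1, Finset.sum_neg_distrib]
  rw [Finset.sum_comm]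
  simp only [← Finset.mul_sum]
  congr 1
  -- Permuting the coordinates of `s` by `σ` replaces the edges of `σ` by the fixed edges `ε₀₁`,
  -- `ε₀₂`; the sum then splits into the part that cancels and the part on the face.
  have h3 : ∀ σ : Equiv.Perm (Fin 4), ∑ s : SubsimplexIndex n,
      φ Δ (s.1 + (firstEdge σ).vec) * ψ Δ (s.1 + (secondEdge σ).vec) =
      ∑ s : SubsimplexIndex n, (if ¬ s.1 3 = 0 then
        φ Δ ((s.1 + (firstEdge 1).vec) ∘ σ.symm) * ψ Δ ((s.1 + (secondEdge 1).vec) ∘ σ.symm)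
        else 0) +
      ∑ s : SubsimplexIndex n, (if s.1 3 = 0 then
        φ Δ ((s.1 + (firstEdge 1).vec) ∘ σ.symm) * ψ Δ ((s.1 + (secondEdge 1).vec) ∘ σ.symm)
        else 0) := by
    intro σ
    rw [← Equiv.sum_comp (SubsimplexIndex.permute σ), ← Finset.sum_add_distrib]
    refine Finset.sum_congr rfl fun s _ => ?_
    have e1 := add_vec_comp σ s.1 0 1 (by decide)
    have e2 := add_vec_comp σ s.1 0 2 (by decide)
    have e3 : (SubsimplexIndex.permute σ s).1 = s.1 ∘ σ.symm := rfl
    unfold firstEdge secondEdge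
    rw [e3, e1, e2]
    split_ifs <;> simp
  simp only [h3, mul_add, Finset.sum_add_distrib]
  rw [sum_interior_eq_zero, zero_add]
  refine Finset.sum_congr rfl fun σ _ => ?_
  congr 1
  rw [sum_index_eq_sum_triples (fun s =>
    φ Δ ((s + (firstEdge 1).vec) ∘ σ.symm) * ψ Δ ((s + (secondEdge 1).vec) ∘ σ.symm))]
  have e1 : (firstEdge 1).vec = ![1, 1, 0, 0] := by decide
  have e2 : (secondEdge 1).vec = ![1, 0, 1, 0] := by decide
  simp [e1, e2, faceValue]

/-! ## The pairing of functions on faces -/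

/-- `ijk ↦ jik`. -/
def BdFlag.rev {T : Type*} (f : BdFlag T) : BdFlag T := (f.1, f.2 * Equiv.swap 0 1)

/-- `ijk ↦ kji`. -/
def BdFlag.flip {T : Type*} (f : BdFlag T) : BdFlag T := (f.1, f.2 * Equiv.swap 0 2)

theorem BdFlag.sgn_rev {T : Type*} (f : BdFlag T) : f.rev.sgn = -f.sgn := by
  simp [BdFlag.rev, BdFlag.sgn]

theorem BdFlag.rev_rev {T : Type*} (f : BdFlag T) : f.rev.rev = f := by
  simp [BdFlag.rev, mul_assoc]

theorem BdFlag.flip_rev {T : Type*} (f : BdFlag T) : f.rev.flip = f.flip.mu := by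
  have h : Equiv.swap (0 : Fin 4) 1 * Equiv.swap 0 2 = Equiv.swap 0 2 * Equiv.swap 1 2 := by
    decide
  simp [BdFlag.rev, BdFlag.flip, BdFlag.mu, mul_assoc, h]

theorem BdFlag.kap_rev {T : Type*} (f : BdFlag T) : f.kap.rev = f.rev.kap := by
  have h : Equiv.swap (2 : Fin 4) 3 * Equiv.swap 0 1 = Equiv.swap 0 1 * Equiv.swap 2 3 := by
    decide
  simp [BdFlag.rev, BdFlag.kap, mul_assoc, h]

theorem OrientedTriangulation.cross_rev {T : Type*} (𝒯 : OrientedTriangulation T) (f : BdFlag T) :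
    𝒯.cross f.rev = (𝒯.cross f).rev := by
  have h : Equiv.swap (0 : Fin 4) 1 3 = 3 := by decide
  simp [OrientedTriangulation.cross, BdFlag.rev, mul_assoc, h]

theorem OrientedTriangulation.cross_flip {T : Type*} (𝒯 : OrientedTriangulation T)
    (f : BdFlag T) : 𝒯.cross f.flip = (𝒯.cross f).flip := by
  have h : Equiv.swap (0 : Fin 4) 2 3 = 3 := by decide
  simp [OrientedTriangulation.cross, BdFlag.flip, mul_assoc, h]

section

variable {T : Type*} [Fintype T] [DecidableEq T]

theorem sum_sgn_comp {τ : BdFlag T → BdFlag T} (h1 : Function.Involutive τ)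
    (h2 : ∀ f, (τ f).sgn = -f.sgn) (H : BdFlag T → ℤ) :
    ∑ f, f.sgn * H (τ f) = -∑ f, f.sgn * H f := by
  rw [← Equiv.sum_comp h1.toPerm fun f => f.sgn * H f]
  simp [h2]

theorem sum_sgn_eq_zero {τ : BdFlag T → BdFlag T} (h1 : Function.Involutive τ)
    (h2 : ∀ f, (τ f).sgn = -f.sgn) (H : BdFlag T → ℤ) (h3 : ∀ f, H (τ f) = H f) :
    ∑ f, f.sgn * H f = 0 := by
  have := sum_sgn_comp h1 h2 H
  simp only [h3] at this
  linarith

theorem sum_triples_swap_right (n : ℕ) (F : ℕ → ℕ → ℕ → ℤ) :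
    ∑ p ∈ triples n, F p.1 p.2.2 p.2.1 = ∑ p ∈ triples n, F p.1 p.2.1 p.2.2 := by
  refine Finset.sum_nbij' (fun p => (p.1, p.2.2, p.2.1)) (fun p => (p.1, p.2.2, p.2.1))
    ?_ ?_ ?_ ?_ ?_ <;> simp [mem_triples] <;> omega

theorem sum_triples_swap_left (n : ℕ) (F : ℕ → ℕ → ℕ → ℤ) :
    ∑ p ∈ triples n, F p.2.1 p.1 p.2.2 = ∑ p ∈ triples n, F p.1 p.2.1 p.2.2 := by
  refine Finset.sum_nbij' (fun p => (p.2.1, p.1, p.2.2)) (fun p => (p.2.1, p.1, p.2.2))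
    ?_ ?_ ?_ ?_ ?_ <;> simp [mem_triples] <;> omega

/-- A family of functions on flags that is induced by functions on the faces. -/
structure IsFaceFamily (Φ : BdFlag T → ℕ → ℕ → ℕ → ℤ) : Prop where
  mu : ∀ f x y z, Φ f.mu x y z = Φ f x z y
  rev : ∀ f x y z, Φ f.rev x y z = Φ f y x z

theorem faceValue_mul (φ : T → (Fin 4 → ℕ) → ℤ) (Δ : T) (σ κ : Equiv.Perm (Fin 4))
    {x y z x' y' z' : ℕ} (h : ![x, y, z, 0] ∘ κ.symm = ![x', y', z', 0]) :
    faceValue φ (Δ, σ * κ) x y z = faceValue φ (Δ, σ) x' y' z' := by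
  simp only [faceValue, ← h]
  rfl

theorem isFaceFamily_faceValue (φ : T → (Fin 4 → ℕ) → ℤ) : IsFaceFamily (faceValue φ) where
  mu f x y z := faceValue_mul φ _ _ _ (by
    ext m; fin_cases m <;> simp [Equiv.swap_apply_of_ne_of_ne])
  rev f x y z := faceValue_mul φ _ _ _ (by
    ext m; fin_cases m <;> simp [Equiv.swap_apply_of_ne_of_ne])

/-- A point whose third coordinate is zero lies on the edge `ij`, which the faces `ijk` and `ijl`
share. -/
theorem faceValue_kap (φ : T → (Fin 4 → ℕ) → ℤ) (f : BdFlag T) (x y : ℕ) :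
    faceValue φ f.kap x y 0 = faceValue φ f x y 0 :=
  faceValue_mul φ _ _ _ (by
    ext m; fin_cases m <;> simp [Equiv.swap_apply_of_ne_of_ne])

theorem facePairing_skew (n : ℕ) {Φ Ψ : BdFlag T → ℕ → ℕ → ℕ → ℤ} (hΦ : IsFaceFamily Φ)
    (hΨ : IsFaceFamily Ψ) : facePairing n Φ Ψ = -facePairing n Ψ Φ := by
  unfold facePairing
  rw [← sum_sgn_comp (τ := BdFlag.mu) OrientedTriangulation.mu_mu OrientedTriangulation.sgn_mu]
  refine Finset.sum_congr rfl fun f _ => ?_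
  congr 1
  rw [← sum_triples_swap_right n fun x y z => Φ f (x + 1) (y + 1) z * Ψ f (x + 1) y (z + 1)]
  exact Finset.sum_congr rfl fun p _ => by rw [hΦ.mu, hΨ.mu, mul_comm]

theorem facePairing_sub_right (n : ℕ) (Φ Ψ Ψ' : BdFlag T → ℕ → ℕ → ℕ → ℤ) :
    facePairing n Φ (fun f x y z => Ψ f x y z - Ψ' f x y z) =
      facePairing n Φ Ψ - facePairing n Φ Ψ' := by
  simp only [facePairing, mul_sub, Finset.sum_sub_distrib]

/-- The second argument is sampled only where the first and third coordinates are positive, so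
vertex points never matter. -/
theorem facePairing_congr_right {n : ℕ} {Φ Ψ Ψ' : BdFlag T → ℕ → ℕ → ℕ → ℤ}
    (h : ∀ f x y z, x + y + z + 2 = n → Ψ f (x + 1) y (z + 1) = Ψ' f (x + 1) y (z + 1)) :
    facePairing n Φ Ψ = facePairing n Φ Ψ' := by
  unfold facePairing
  refine Finset.sum_congr rfl fun f _ => congrArg _ (Finset.sum_congr rfl fun p hp => ?_)
  rw [h _ _ _ _ (mem_triples.1 hp)]

theorem facePairing_cross (𝒯 : OrientedTriangulation T) (n : ℕ)
    (Φ Ψ : BdFlag T → ℕ → ℕ → ℕ → ℤ) :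
    facePairing n (fun f => Φ (𝒯.cross f)) (fun f => Ψ (𝒯.cross f)) = -facePairing n Φ Ψ :=
  sum_sgn_comp 𝒯.cross_cross 𝒯.sgn_cross fun f => ∑ p ∈ triples n,
    Φ f (p.1 + 1) (p.2.1 + 1) p.2.2 * Ψ f (p.1 + 1) p.2.1 (p.2.2 + 1)

theorem IsFaceFamily.comp_cross (𝒯 : OrientedTriangulation T) {Φ : BdFlag T → ℕ → ℕ → ℕ → ℤ}
    (hΦ : IsFaceFamily Φ) : IsFaceFamily fun f => Φ (𝒯.cross f) where
  mu f x y z := by rw [OrientedTriangulation.cross_mu, hΦ.mu]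
  rev f x y z := by rw [OrientedTriangulation.cross_rev, hΦ.rev]

/-- Crossing the faces negates `facePairing` because it reverses `sgn`. Hence `⟨Φ, Ψ∘cross⟩ =
-⟨Φ∘cross, Ψ⟩`, and by skew-symmetry the mixed terms on the right cancel. -/
theorem two_mul_facePairing (𝒯 : OrientedTriangulation T) (n : ℕ)
    {Φ Ψ : BdFlag T → ℕ → ℕ → ℕ → ℤ} (hΦ : IsFaceFamily Φ) (hΨ : IsFaceFamily Ψ) :
    2 * facePairing n Φ Ψ =
      facePairing n Φ (fun f x y z => Ψ f x y z - Ψ (𝒯.cross f) x y z) -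
      facePairing n Ψ (fun f x y z => Φ f x y z - Φ (𝒯.cross f) x y z) := by
  rw [facePairing_sub_right, facePairing_sub_right]
  have h1 := facePairing_cross 𝒯 n Φ fun f => Ψ (𝒯.cross f)
  simp only [𝒯.cross_cross] at h1
  have h2 := facePairing_skew n hΦ hΨ
  have h3 := facePairing_skew n (hΦ.comp_cross 𝒯) hΨ
  change 2 * facePairing n Φ Ψ = facePairing n Φ Ψ - facePairing n Φ (fun f => Ψ (𝒯.cross f))
    - (facePairing n Ψ Φ - facePairing n Ψ (fun f => Φ (𝒯.cross f)))
  linarith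

/-! ### Pairing with level functions: from faces to edges -/

/-- The function on the face `ijk` that is the sum of the indicator functions of `t_i = m`,
`t_j = m` and `t_k = m`, weighted by `D`. -/
def levelFamily (D : BdFlag T → ℤ) (m : ℕ) (f : BdFlag T) (x y z : ℕ) : ℤ :=
  (if x = m then D f else 0) + (if y = m then D f.rev else 0) + (if z = m then D f.flip else 0)

/-- The weighted sum of the values at the integral points `t` with `t_i = m + 1` on the
edges `ij`. -/
def edgeSum (n : ℕ) (D : BdFlag T → ℤ) (Φ : BdFlag T → ℕ → ℕ → ℕ → ℤ) (m : ℕ) : ℤ :=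
  ∑ f : BdFlag T, f.sgn * (D f * if m + 2 ≤ n then Φ f (m + 1) (n - 1 - m) 0 else 0)

/-- On the line of points at level `m + 1` in a face, exchanging the last two coordinates reverses
the sign, so all points with both of these positive cancel. Only the end on the edge `ij` survives.
For `m + 2 > n` there is no triple at this level, which is the reason for the guard in `edgeSum`; at
`m + 1 = n` it excludes the vertex point. -/
theorem sum_level_eq_edgeSum (n m : ℕ) {D : BdFlag T → ℤ} {Φ : BdFlag T → ℕ → ℕ → ℕ → ℤ}
    (hD : ∀ f : BdFlag T, D f.mu = D f) (hΦ : IsFaceFamily Φ) :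
    ∑ f : BdFlag T, f.sgn * (D f * ∑ p ∈ triples n,
      if p.1 = m then Φ f (p.1 + 1) (p.2.1 + 1) p.2.2 else 0) = edgeSum n D Φ m := by
  have h1 : ∑ f : BdFlag T, f.sgn * (D f * ∑ p ∈ triples n,
      if p.1 = m ∧ p.2.2 ≠ 0 then Φ f (p.1 + 1) (p.2.1 + 1) p.2.2 else 0) = 0 := by
    refine sum_sgn_eq_zero (τ := BdFlag.mu) OrientedTriangulation.mu_mu
      OrientedTriangulation.sgn_mu (fun f => D f * ∑ p ∈ triples n,
      if p.1 = m ∧ p.2.2 ≠ 0 then Φ f (p.1 + 1) (p.2.1 + 1) p.2.2 else 0) fun f => ?_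
    simp only [hD, hΦ.mu, ← Finset.sum_filter]
    congr 1
    -- The sampled point is `(x + 1, y + 1, z)`; this map exchanges its last two coordinates.
    refine Finset.sum_nbij' (fun p => (p.1, p.2.2 - 1, p.2.1 + 1))
      (fun p => (p.1, p.2.2 - 1, p.2.1 + 1)) ?_ ?_ ?_ ?_ ?_
    · intro p hp
      simp only [Finset.mem_filter, mem_triples] at hp ⊢
      omega
    · intro p hp
      simp only [Finset.mem_filter, mem_triples] at hp ⊢
      omega
    · intro p hp
      simp only [Finset.mem_filter, mem_triples] at hp
      ext <;> dsimp only <;> omega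
    · intro p hp
      simp only [Finset.mem_filter, mem_triples] at hp
      ext <;> dsimp only <;> omega
    · intro p hp
      simp only [Finset.mem_filter, mem_triples] at hp
      rw [Nat.sub_add_cancel (by omega)]
  refine (sub_zero _).symm.trans ((congrArg _ h1.symm).trans ?_)
  rw [← Finset.sum_sub_distrib]
  refine Finset.sum_congr rfl fun f _ => ?_
  rw [← mul_sub, ← mul_sub, ← Finset.sum_sub_distrib]
  congr 2
  have h2 : ∀ p ∈ triples n, ((if p.1 = m then Φ f (p.1 + 1) (p.2.1 + 1) p.2.2 else 0) -
      if p.1 = m ∧ p.2.2 ≠ 0 then Φ f (p.1 + 1) (p.2.1 + 1) p.2.2 else 0) =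
      if p = (m, n - 2 - m, 0) then (if m + 2 ≤ n then Φ f (m + 1) (n - 1 - m) 0 else 0)
        else 0 := by
    rintro ⟨x, y, z⟩ hp
    rw [mem_triples] at hp
    dsimp only at hp
    by_cases hx : x = m
    · by_cases hz : z = 0
      · subst hx hz
        have e1 : y = n - 2 - x := by omega
        have e2 : y + 1 = n - 1 - x := by omega
        have e3 : x + 2 ≤ n := by omega
        simp [← e1, e2, e3]
      · simp [hx, hz]
    · simp [hx]
  rw [Finset.sum_congr rfl h2, Finset.sum_ite_eq']
  split_ifs with h3 h4 h4
  · rfl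
  · rfl
  · exact absurd (mem_triples.2 (by dsimp only; omega)) h3
  · rfl

/-- The level at the third vertex is symmetric under `rev` and cancels. The levels at the first and
second vertex give edge sums with opposite signs; their indices differ by one because the two
sampled points differ by a step from the second vertex to the third. -/
theorem facePairing_levelFamily (n m : ℕ) {D : BdFlag T → ℤ} {Φ : BdFlag T → ℕ → ℕ → ℕ → ℤ}
    (hD : ∀ f : BdFlag T, D f.mu = D f) (hΦ : IsFaceFamily Φ) :
    facePairing n Φ (levelFamily D (m + 1)) = edgeSum n D Φ m - edgeSum n D Φ (m + 1) := by
  have h1 : facePairing n Φ (levelFamily D (m + 1)) =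
      ∑ f : BdFlag T, f.sgn * (D f * ∑ p ∈ triples n,
        if p.1 = m then Φ f (p.1 + 1) (p.2.1 + 1) p.2.2 else 0) +
      ∑ f : BdFlag T, f.sgn * (D f.rev * ∑ p ∈ triples n,
        if p.2.1 = m + 1 then Φ f (p.1 + 1) (p.2.1 + 1) p.2.2 else 0) +
      ∑ f : BdFlag T, f.sgn * (D f.flip * ∑ p ∈ triples n,
        if p.2.2 = m then Φ f (p.1 + 1) (p.2.1 + 1) p.2.2 else 0) := by
    simp only [← Finset.sum_add_distrib, ← mul_add, Finset.mul_sum, facePairing, levelFamily]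
    refine Finset.sum_congr rfl fun f _ => Finset.sum_congr rfl fun p _ => ?_
    simp only [Nat.add_right_cancel_iff]
    split_ifs <;> ring
  have h2 : ∑ f : BdFlag T, f.sgn * (D f.flip * ∑ p ∈ triples n,
      if p.2.2 = m then Φ f (p.1 + 1) (p.2.1 + 1) p.2.2 else 0) = 0 := by
    refine sum_sgn_eq_zero (τ := BdFlag.rev) BdFlag.rev_rev BdFlag.sgn_rev
      (fun f => D f.flip * ∑ p ∈ triples n,
        if p.2.2 = m then Φ f (p.1 + 1) (p.2.1 + 1) p.2.2 else 0) fun f => ?_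
    simp only [BdFlag.flip_rev, hD, hΦ.rev]
    congr 1
    exact sum_triples_swap_left n fun x y z => if z = m then Φ f (x + 1) (y + 1) z else 0
  have h3 := sum_sgn_comp (τ := BdFlag.rev) BdFlag.rev_rev BdFlag.sgn_rev
    (fun f => D f * ∑ p ∈ triples n,
        if p.2.1 = m + 1 then Φ f.rev (p.1 + 1) (p.2.1 + 1) p.2.2 else 0)
  have h4 : ∑ f : BdFlag T, f.sgn * (D f * ∑ p ∈ triples n,
        if p.2.1 = m + 1 then Φ f.rev (p.1 + 1) (p.2.1 + 1) p.2.2 else 0) =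
      edgeSum n D Φ (m + 1) := by
    rw [← sum_level_eq_edgeSum n (m + 1) hD hΦ]
    refine Finset.sum_congr rfl fun f _ => ?_
    congr 2
    simp only [hΦ.rev]
    exact sum_triples_swap_left n fun x y z => if x = m + 1 then Φ f (x + 1) (y + 1) z else 0
  simp only [BdFlag.rev_rev] at h3
  rw [h1, h2, sum_level_eq_edgeSum n m hD hΦ, h3, h4]
  ring

end

/-! ## The functions on integral points that define the equations -/

section

variable {T : Type*} [Fintype T] [DecidableEq T] (𝒯 : OrientedTriangulation T)

open Classical in
/-- The indicator function of an integral point of the triangulation. -/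
def gluingFunction {n : ℕ} (p : 𝒯.NonVertexPoint n) (Δ : T) (t : Fin 4 → ℕ) : ℤ :=
  if ∃ h : ∑ i, t i = n, Quot.mk 𝒯.FacePaired (Δ, ⟨t, h⟩) = p.1 then 1 else 0

theorem gluingSum_eq_pointSum {M : Type*} [AddCommGroup M] (w : Edge → M) {n : ℕ}
    (p : 𝒯.NonVertexPoint n) : 𝒯.gluingSum w p = pointSum w (gluingFunction 𝒯 p) := by
  funext c
  refine Finset.sum_congr rfl fun e _ => ?_
  have h : (∃ h : ∑ i, (c.2.1 + e.vec) i = n,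
      Quot.mk 𝒯.FacePaired (c.1, ⟨c.2.1 + e.vec, h⟩) = p.1) ↔
      Quot.mk 𝒯.FacePaired (c.midpoint e) = p.1 :=
    ⟨fun ⟨_, h⟩ => h, fun h => ⟨(c.midpoint e).2.2, h⟩⟩
  by_cases hc : Quot.mk 𝒯.FacePaired (c.midpoint e) = p.1
  · simp only [gluingFunction, if_pos (h.2 hc), if_pos hc, one_smul]
  · simp only [gluingFunction, if_neg (mt h.1 hc), if_neg hc, zero_smul]

theorem faceValue_gluingFunction_cross {n : ℕ} (p : 𝒯.NonVertexPoint n) (f : BdFlag T) :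
    faceValue (gluingFunction 𝒯 p) (𝒯.cross f) = faceValue (gluingFunction 𝒯 p) f := by
  funext x y z
  have hs : ∀ σ : Equiv.Perm (Fin 4), ∑ i, (![x, y, z, 0] ∘ σ.symm) i =
      ∑ i, ![x, y, z, 0] i := fun σ => Equiv.sum_comp σ.symm ![x, y, z, 0]
  have h : ∀ h1 h2, Quot.mk 𝒯.FacePaired
      ((𝒯.cross f).1, (⟨![x, y, z, 0] ∘ (𝒯.cross f).2.symm, h1⟩ :
        {t : Fin 4 → ℕ // ∑ i, t i = n})) =
      Quot.mk 𝒯.FacePaired (f.1, ⟨![x, y, z, 0] ∘ f.2.symm, h2⟩) := by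
    intro h1 h2
    refine (Quot.sound ⟨f.2 3, by simp, rfl, fun i => ?_⟩).symm
    simp [OrientedTriangulation.cross, Equiv.Perm.mul_def]
  unfold faceValue gluingFunction
  congr 1
  refine propext ⟨fun ⟨h1, h3⟩ => ?_, fun ⟨h2, h3⟩ => ?_⟩
  · have h2 := (hs f.2).trans ((hs _).symm.trans h1)
    exact ⟨h2, (h h1 h2).symm.trans h3⟩
  · have h1 := (hs (𝒯.cross f).2).trans ((hs f.2).symm.trans h2)
    exact ⟨h1, (h h1 h2).trans h3⟩

/-- The function on integral points that defines the cusp equation of `a ⊗ e_{r+1}`. -/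
def cuspFunction (n : ℕ) (a : LocalChain T) (r : ℕ) (Δ : T) (t : Fin 4 → ℕ) : ℤ :=
  ∑ σ : Equiv.Perm (Fin 4),
    ((-(Equiv.Perm.sign σ : ℤ) * a.1 (Δ, σ)) *
        (if t (σ 0) = r + 1 ∧ t (σ 1) = n - 1 - r ∧ t (σ 2) = 0 ∧ t (σ 3) = 0 then 1 else 0)
      + ((Equiv.Perm.sign σ : ℤ) * a.2 (Δ, σ)) *
        (if t (σ 3) = 0 ∧ t (σ 0) = r + 1 ∧ t (σ 1) ≠ 0 ∧ t (σ 2) ≠ 0 then 1 else 0))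

theorem eq_firstEdge_of_vec : ∀ (σ : Equiv.Perm (Fin 4)) (e : Edge),
    e.vec (σ 2) = 0 → e.vec (σ 3) = 0 → e = firstEdge σ := by
  decide +kernel

theorem firstEdge_vec : ∀ (σ : Equiv.Perm (Fin 4)), (firstEdge σ).vec (σ 0) = 1 ∧
    (firstEdge σ).vec (σ 1) = 1 ∧ (firstEdge σ).vec (σ 2) = 0 ∧ (firstEdge σ).vec (σ 3) = 0 := by
  decide +kernel

theorem forall_perm_iff (σ : Equiv.Perm (Fin 4)) (P : Fin 4 → Prop) :
    (∀ i, P i) ↔ P (σ 0) ∧ P (σ 1) ∧ P (σ 2) ∧ P (σ 3) := by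
  rw [← Equiv.forall_congr_right σ, Fin.forall_fin_succ, Fin.forall_fin_succ, Fin.forall_fin_two]
  rfl

/-- A non-vertex point on an edge of the simplex is the midpoint of exactly one edge of one
subsimplex, so the `γ`-contribution can be encoded by its midpoint. -/
theorem midpoint_on_edge_iff {n r : ℕ} (hr : r + 2 ≤ n) (σ : Equiv.Perm (Fin 4)) (e : Edge)
    (s : Fin 4 → ℕ) :
    ((s + e.vec) (σ 0) = r + 1 ∧ (s + e.vec) (σ 1) = n - 1 - r ∧ (s + e.vec) (σ 2) = 0 ∧
      (s + e.vec) (σ 3) = 0) ↔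
    e = firstEdge σ ∧ s = Pi.single (σ 0) r + Pi.single (σ 1) (n - 2 - r) := by
  have h1 : s = Pi.single (σ 0) r + Pi.single (σ 1) (n - 2 - r) ↔
      s (σ 0) = r ∧ s (σ 1) = n - 2 - r ∧ s (σ 2) = 0 ∧ s (σ 3) = 0 := by
    rw [funext_iff, forall_perm_iff σ]
    simp
  rw [h1]
  obtain ⟨v0, v1, v2, v3⟩ := firstEdge_vec σ
  simp only [Pi.add_apply]
  constructor
  · rintro ⟨h0, h1, h2, h3⟩
    obtain rfl := eq_firstEdge_of_vec σ e (by omega) (by omega)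
    refine ⟨rfl, ?_, ?_, ?_, ?_⟩ <;> omega
  · rintro ⟨rfl, h0, h1, h2, h3⟩
    refine ⟨?_, ?_, ?_, ?_⟩ <;> omega

theorem cuspSum_eq_pointSum {M : Type*} [AddCommGroup M] (w : Edge → M) {n : ℕ}
    (a : LocalChain T) (r : Fin (n - 1)) :
    OrientedTriangulation.cuspSum w a r = pointSum (n := n) w (cuspFunction n a r) := by
  funext c
  simp only [pointSum, cuspFunction, Finset.sum_smul]
  rw [Finset.sum_comm]
  refine Finset.sum_congr rfl fun σ _ => ?_
  simp only [add_smul, mul_smul _ (ite _ _ _), Finset.sum_add_distrib, ← Finset.smul_sum]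
  have hr : r.1 + 2 ≤ n := by omega
  congr 2
  · simp only [midpoint_on_edge_iff hr, ite_smul, one_smul, zero_smul, ite_and,
      Finset.sum_ite_eq', Finset.mem_univ, if_true]
    rfl
  · refine Finset.sum_congr rfl fun e _ => ?_
    simp only [ite_smul, one_smul, zero_smul]
    rfl

/-! ### Coefficients of a cycle and the jump of its weight -/

/-- The coefficient of the edge points near `i` on the edge `ij`. -/
def gammaCoeff (a : LocalChain T) (f : BdFlag T) : ℤ := f.sgn * (a.1 f - a.1 f.kap)

/-- The coefficient of the face points near `i` on the face `ijk`. -/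
def betaCoeff (a : LocalChain T) (f : BdFlag T) : ℤ := f.sgn * (a.2 f - a.2 f.mu)

theorem gammaCoeff_kap (a : LocalChain T) (f : BdFlag T) :
    gammaCoeff a f.kap = gammaCoeff a f := by
  simp only [gammaCoeff, OrientedTriangulation.sgn_kap, OrientedTriangulation.kap_kap]; ring

theorem betaCoeff_mu (a : LocalChain T) (f : BdFlag T) :
    betaCoeff a f.mu = betaCoeff a f := by
  simp only [betaCoeff, OrientedTriangulation.sgn_mu, OrientedTriangulation.mu_mu]; ring

/-- This is the cycle condition at the vertex shared by the two simplices, the change of `sgn` under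
`cross` being absorbed into the coefficients. -/
theorem coeff_cross {a : LocalChain T} (ha : a ∈ 𝒯.cycles) (f : BdFlag T) :
    gammaCoeff a (𝒯.cross f) + betaCoeff a (𝒯.cross f) = gammaCoeff a f + betaCoeff a f := by
  have h := 𝒯.boundary_add_cross ha f
  simp only [OrientedTriangulation.localBoundary, LinearMap.coe_mk, AddHom.coe_mk] at h
  simp only [gammaCoeff, betaCoeff, OrientedTriangulation.sgn_cross]
  linear_combination f.sgn * h

/-- The jump of the coefficient of the face points when passing to the neighboring simplex. -/
def coeffJump (a : LocalChain T) (f : BdFlag T) : ℤ := betaCoeff a f - betaCoeff a (𝒯.cross f)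

theorem coeffJump_mu (a : LocalChain T) (f : BdFlag T) :
    coeffJump 𝒯 a f.mu = coeffJump 𝒯 a f := by
  simp only [coeffJump, OrientedTriangulation.cross_mu, betaCoeff_mu]

theorem coeffJump_eq {a : LocalChain T} (ha : a ∈ 𝒯.cycles) (f : BdFlag T) :
    coeffJump 𝒯 a f = gammaCoeff a (𝒯.cross f) - gammaCoeff a f := by
  have := coeff_cross 𝒯 ha f
  unfold coeffJump
  linarith

theorem faceValue_cuspFunction (n : ℕ) (a : LocalChain T) (r : ℕ) (f : BdFlag T) (x y z : ℕ) :
    faceValue (cuspFunction n a r) f x y z = ∑ ρ : Equiv.Perm (Fin 4),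
      ((-((Equiv.Perm.sign ρ : ℤ) * f.sgn) * a.1 (f.1, f.2 * ρ)) *
        (if ![x, y, z, 0] (ρ 0) = r + 1 ∧ ![x, y, z, 0] (ρ 1) = n - 1 - r ∧
          ![x, y, z, 0] (ρ 2) = 0 ∧ ![x, y, z, 0] (ρ 3) = 0 then 1 else 0)
      + (((Equiv.Perm.sign ρ : ℤ) * f.sgn) * a.2 (f.1, f.2 * ρ)) *
        (if ![x, y, z, 0] (ρ 3) = 0 ∧ ![x, y, z, 0] (ρ 0) = r + 1 ∧
          ![x, y, z, 0] (ρ 1) ≠ 0 ∧ ![x, y, z, 0] (ρ 2) ≠ 0 then 1 else 0)) := by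
  unfold faceValue cuspFunction
  rw [← Equiv.sum_comp (Equiv.mulLeft f.2)]
  refine Finset.sum_congr rfl fun ρ _ => ?_
  simp only [Equiv.coe_mulLeft, Function.comp_apply, Equiv.Perm.mul_apply,
    Equiv.symm_apply_apply, Equiv.Perm.sign_mul, Units.val_mul, BdFlag.sgn]
  ring

theorem faceValue_cuspFunction_edge {n : ℕ} (a : LocalChain T) (r : ℕ) (f : BdFlag T) {x y : ℕ}
    (hx : x ≠ 0) (hy : y ≠ 0) (hn : x + y = n) :
    faceValue (cuspFunction n a r) f x y 0 =
      -(if x = r + 1 then gammaCoeff a f else 0)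
      - (if y = r + 1 then gammaCoeff a f.rev else 0) := by
  -- A `γ`-term can be nonzero only for permutations preserving `{0, 1}`.
  have key : ∀ ρ : Equiv.Perm (Fin 4), ρ ∈ ({1, Equiv.swap 2 3, Equiv.swap 0 1,
      Equiv.swap 0 1 * Equiv.swap 2 3} : Finset (Equiv.Perm (Fin 4))) ∨
      (ρ 2 = 0 ∨ ρ 2 = 1) ∨ (ρ 3 = 0 ∨ ρ 3 = 1) := by decide
  have key2 : ∀ ρ : Equiv.Perm (Fin 4),
      (ρ 0 = 2 ∨ ρ 0 = 3) ∨ (ρ 1 = 2 ∨ ρ 1 = 3) ∨ ρ 2 = 2 ∨ ρ 2 = 3 := by decide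
  -- A `β`-term needs three nonzero coordinates, so none occurs on an edge.
  have hb : ∀ ρ : Equiv.Perm (Fin 4), ¬ (![x, y, 0, 0] (ρ 3) = 0 ∧
      ![x, y, 0, 0] (ρ 0) = r + 1 ∧ ![x, y, 0, 0] (ρ 1) ≠ 0 ∧ ![x, y, 0, 0] (ρ 2) ≠ 0) := by
    rintro ρ ⟨-, h0, h1, h2⟩
    rcases key2 ρ with (h | h) | (h | h) | h | h <;> simp [h] at h0 h1 h2
  rw [faceValue_cuspFunction]
  simp only [hb, if_false, mul_zero, add_zero]
  rw [← Finset.sum_subset (Finset.subset_univ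
    ({1, Equiv.swap 2 3, Equiv.swap 0 1, Equiv.swap 0 1 * Equiv.swap 2 3} : Finset _))]
  · have e1 : (x = r + 1 ∧ y = n - 1 - r) ↔ x = r + 1 := by omega
    have e2 : (y = r + 1 ∧ x = n - 1 - r) ↔ y = r + 1 := by omega
    rw [Finset.sum_insert (by decide), Finset.sum_insert (by decide),
      Finset.sum_insert (by decide), Finset.sum_singleton]
    simp [Equiv.swap_apply_of_ne_of_ne, e1, e2, gammaCoeff, BdFlag.rev, BdFlag.kap, BdFlag.sgn,
      mul_assoc]
    split_ifs <;> ring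
  · intro ρ _ hρ
    rcases (key ρ).resolve_left hρ with (h | h) | h | h <;> simp [h, hx, hy]

theorem faceValue_cuspFunction_interior (n : ℕ) (a : LocalChain T) (r : ℕ) (f : BdFlag T)
    {x y z : ℕ} (hx : x ≠ 0) (hy : y ≠ 0) (hz : z ≠ 0) :
    faceValue (cuspFunction n a r) f x y z = levelFamily (betaCoeff a) (r + 1) f x y z := by
  have key : ∀ ρ : Equiv.Perm (Fin 4), ρ ∈ ({1, Equiv.swap 1 2, Equiv.swap 0 1,
      Equiv.swap 0 1 * Equiv.swap 1 2, Equiv.swap 0 2, Equiv.swap 0 2 * Equiv.swap 1 2} :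
        Finset (Equiv.Perm (Fin 4))) ∨ (ρ 3 = 0 ∨ ρ 3 = 1 ∨ ρ 3 = 2) := by decide
  rw [faceValue_cuspFunction, ← Finset.sum_subset (Finset.subset_univ
    ({1, Equiv.swap 1 2, Equiv.swap 0 1, Equiv.swap 0 1 * Equiv.swap 1 2, Equiv.swap 0 2,
      Equiv.swap 0 2 * Equiv.swap 1 2} : Finset _))]
  · rw [Finset.sum_insert (by decide), Finset.sum_insert (by decide),
      Finset.sum_insert (by decide), Finset.sum_insert (by decide),
      Finset.sum_insert (by decide), Finset.sum_singleton]
    simp [Equiv.swap_apply_of_ne_of_ne, hx, hy, hz, levelFamily, betaCoeff, BdFlag.rev,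
      BdFlag.flip, BdFlag.mu, BdFlag.sgn, mul_assoc]
    split_ifs <;> ring
  · intro ρ _ hρ
    rcases (key ρ).resolve_left hρ with h | h | h <;> simp [h, hx, hy, hz]

theorem BdFlag.rev_mu (f : BdFlag T) : f.mu.rev = f.flip.mu := by
  have h : Equiv.swap (1 : Fin 4) 2 * Equiv.swap 0 1 = Equiv.swap 0 2 * Equiv.swap 1 2 := by
    decide
  simp [BdFlag.rev, BdFlag.flip, BdFlag.mu, mul_assoc, h]

/-- Interior face points see `β`-coefficients and edge points see minus the `γ`-coefficients; for a
cycle both have the same jump. -/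
theorem faceValue_cuspFunction_sub_cross {n : ℕ} {a : LocalChain T} (ha : a ∈ 𝒯.cycles) (r : ℕ)
    (f : BdFlag T) {x y z : ℕ} (h : x + y + z + 2 = n) :
    faceValue (cuspFunction n a r) f (x + 1) y (z + 1)
      - faceValue (cuspFunction n a r) (𝒯.cross f) (x + 1) y (z + 1) =
      levelFamily (coeffJump 𝒯 a) (r + 1) f (x + 1) y (z + 1) := by
  rcases Nat.eq_zero_or_pos y with rfl | hy
  -- The point lies on the edge `ik`; `mu` renames this edge to `ij`.
  · have e : ∀ g : BdFlag T, faceValue (cuspFunction n a r) g (x + 1) 0 (z + 1) =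
        faceValue (cuspFunction n a r) g.mu (x + 1) (z + 1) 0 := fun g =>
      ((isFaceFamily_faceValue _).mu g _ _ _).symm
    have e1 := coeffJump_eq 𝒯 ha f.mu
    have e2 := coeffJump_eq 𝒯 ha f.flip.mu
    rw [coeffJump_mu] at e1 e2
    rw [e, e, faceValue_cuspFunction_edge _ _ _ (by omega) (by omega) (by omega),
      faceValue_cuspFunction_edge _ _ _ (by omega) (by omega) (by omega),
      ← OrientedTriangulation.cross_mu, ← OrientedTriangulation.cross_rev, BdFlag.rev_mu,
      levelFamily, e1, e2]
    simp only [(Nat.succ_ne_zero r).symm, if_false]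
    split_ifs <;> ring
  · rw [faceValue_cuspFunction_interior _ _ _ _ (by omega) (by omega) (by omega),
      faceValue_cuspFunction_interior _ _ _ _ (by omega) (by omega) (by omega)]
    simp only [levelFamily, coeffJump, OrientedTriangulation.cross_rev,
      OrientedTriangulation.cross_flip]
    split_ifs <;> ring

end

/-! ## Evaluation of the pairing -/

section

variable {T : Type*} [Fintype T] [DecidableEq T] (𝒯 : OrientedTriangulation T)

theorem sum_sgn_kap_eq_zero {H : BdFlag T → ℤ} (h : ∀ f, H f.kap = H f) :
    ∑ f, f.sgn * H f = 0 :=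
  sum_sgn_eq_zero OrientedTriangulation.kap_kap OrientedTriangulation.sgn_kap H h

/-- The jump is a difference of `γ`-coefficients on the two sides. By invariance of `φ` both halves
reduce, up to sign, to one sum, which `kap` negates. -/
theorem edgeSum_of_invariant (n : ℕ) {a : LocalChain T} (ha : a ∈ 𝒯.cycles)
    (φ : T → (Fin 4 → ℕ) → ℤ) (hφ : ∀ f, faceValue φ (𝒯.cross f) = faceValue φ f) (m : ℕ) :
    edgeSum n (coeffJump 𝒯 a) (faceValue φ) m = 0 := by
  have h1 : ∑ f : BdFlag T, f.sgn * (gammaCoeff a f *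
      if m + 2 ≤ n then faceValue φ f (m + 1) (n - 1 - m) 0 else 0) = 0 :=
    sum_sgn_kap_eq_zero fun f => by rw [gammaCoeff_kap, faceValue_kap]
  have h2 := sum_sgn_comp 𝒯.cross_cross 𝒯.sgn_cross fun f => gammaCoeff a f *
      if m + 2 ≤ n then faceValue φ f (m + 1) (n - 1 - m) 0 else 0
  simp only [hφ, h1] at h2
  simp only [edgeSum, coeffJump_eq 𝒯 ha, sub_mul, mul_sub, Finset.sum_sub_distrib, h1, h2]
  rfl

/-! ### Pairings of `γ`-coefficients and the intersection number -/

/-- The pairing of `γ`-coefficients at the two sides of the faces. -/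
def crossPairing (a b : LocalChain T) : ℤ :=
  ∑ f, f.sgn * (gammaCoeff a (𝒯.cross f) * gammaCoeff b f)

/-- The pairing of `γ`-coefficients at the two sides of the faces, at opposite ends of edges. -/
def crossRevPairing (a b : LocalChain T) : ℤ :=
  ∑ f, f.sgn * (gammaCoeff a (𝒯.cross f) * gammaCoeff b f.rev)

theorem crossPairing_skew (a b : LocalChain T) :
    crossPairing 𝒯 a b = -crossPairing 𝒯 b a := by
  have h := sum_sgn_comp 𝒯.cross_cross 𝒯.sgn_cross fun f =>
    gammaCoeff b (𝒯.cross f) * gammaCoeff a f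
  simp only [𝒯.cross_cross] at h
  simp only [crossPairing, ← h, mul_comm (gammaCoeff a _)]

/-- The commuting involutions `cross` and `rev` each reverse the sign; applied together they
exchange `a` and `b` without changing it. -/
theorem crossRevPairing_symm (a b : LocalChain T) :
    crossRevPairing 𝒯 a b = crossRevPairing 𝒯 b a := by
  have h1 := sum_sgn_comp 𝒯.cross_cross 𝒯.sgn_cross fun f =>
    gammaCoeff b (𝒯.cross f) * gammaCoeff a f.rev
  have h2 := sum_sgn_comp BdFlag.rev_rev BdFlag.sgn_rev fun f =>
    gammaCoeff b f.rev * gammaCoeff a (𝒯.cross f)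
  simp only [𝒯.cross_cross, BdFlag.rev_rev, 𝒯.cross_rev] at h1 h2
  unfold crossRevPairing
  rw [← neg_inj, ← h1, h2]
  simp only [mul_comm (gammaCoeff a _)]

theorem edgeSum_cuspFunction {n r m : ℕ} (hr : r + 2 ≤ n) {b : LocalChain T} (hb : b ∈ 𝒯.cycles)
    (a : LocalChain T) :
    edgeSum n (coeffJump 𝒯 b) (faceValue (cuspFunction n a r)) m =
      -(if m = r then crossPairing 𝒯 b a else 0)
      - (if m + r + 2 = n then crossRevPairing 𝒯 b a else 0) := by
  -- The half of the jump that stays in the same simplex cancels under `kap`, so only coefficients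
  -- across a face remain.
  have h1 : ∑ f : BdFlag T, f.sgn * (gammaCoeff b f * gammaCoeff a f) = 0 :=
    sum_sgn_kap_eq_zero fun f => by rw [gammaCoeff_kap, gammaCoeff_kap]
  have h2 : ∑ f : BdFlag T, f.sgn * (gammaCoeff b f * gammaCoeff a f.rev) = 0 :=
    sum_sgn_kap_eq_zero fun f => by rw [BdFlag.kap_rev, gammaCoeff_kap, gammaCoeff_kap]
  have h3 : ∀ f : BdFlag T, f.sgn * (coeffJump 𝒯 b f *
      if m + 2 ≤ n then faceValue (cuspFunction n a r) f (m + 1) (n - 1 - m) 0 else 0) =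
      -(if m = r then 1 else 0) * (f.sgn * (gammaCoeff b (𝒯.cross f) * gammaCoeff a f)
        - f.sgn * (gammaCoeff b f * gammaCoeff a f))
      - (if m + r + 2 = n then 1 else 0) *
        (f.sgn * (gammaCoeff b (𝒯.cross f) * gammaCoeff a f.rev)
        - f.sgn * (gammaCoeff b f * gammaCoeff a f.rev)) := by
    intro f
    by_cases hm : m + 2 ≤ n
    · have e1 : m + 1 = r + 1 ↔ m = r := by omega
      have e2 : n - 1 - m = r + 1 ↔ m + r + 2 = n := by omega
      rw [if_pos hm, faceValue_cuspFunction_edge _ _ _ (by omega) (by omega) (by omega),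
        coeffJump_eq 𝒯 hb]
      simp only [e1, e2]
      split_ifs <;> ring
    · have e1 : ¬ m = r := by omega
      have e2 : ¬ m + r + 2 = n := by omega
      simp [hm, e1, e2]
  simp only [edgeSum, h3, Finset.sum_sub_distrib, ← Finset.mul_sum, h1, h2]
  unfold crossPairing crossRevPairing
  split_ifs <;> ring

/-- The chain pairing is the signed sum of `γ_a β_b`. Using the cycle condition for `b` to eliminate
`γ_b ∘ cross` from `crossPairing` yields it once; the leftover sum of `γ_a · (β_b ∘ cross)` yields
it again by the cycle condition for `a`. Pure `γγ` and `ββ` sums vanish by `kap` and `mu`. -/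
theorem two_mul_chainPairing {a b : LocalChain T} (ha : a ∈ 𝒯.cycles) (hb : b ∈ 𝒯.cycles) :
    2 * OrientedTriangulation.chainPairing a b = crossPairing 𝒯 b a := by
  have h1 : OrientedTriangulation.chainPairing a b =
      ∑ f, f.sgn * (gammaCoeff a f * betaCoeff b f) := by
    have e2 : OrientedTriangulation.chainPairing a b =
        ∑ f : BdFlag T, a.1 f * betaCoeff b f - ∑ f : BdFlag T, a.1 f * betaCoeff b f.kap := by
      rw [OrientedTriangulation.chainPairing_apply, ← Finset.sum_sub_distrib]
      refine Finset.sum_congr rfl fun f _ => ?_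
      rw [OrientedTriangulation.sum_crossing_right]
      simp only [betaCoeff, OrientedTriangulation.sgn_kap]
      simp only [BdFlag.sgn, BdFlag.mu, BdFlag.kap]
      ring
    have hs : ∀ f : BdFlag T, f.sgn * f.sgn = 1 := fun f => by
      rcases Int.units_eq_one_or (Equiv.Perm.sign f.2) with h | h <;> simp [BdFlag.sgn, h]
    have e3 : ∑ f : BdFlag T, a.1 f * betaCoeff b f.kap =
        ∑ f : BdFlag T, a.1 f.kap * betaCoeff b f := by
      have kapE : Function.Involutive (BdFlag.kap (T := T)) := OrientedTriangulation.kap_kap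
      rw [← Equiv.sum_comp kapE.toPerm]
      simp [OrientedTriangulation.kap_kap]
    rw [e2, e3, ← Finset.sum_sub_distrib]
    refine Finset.sum_congr rfl fun f _ => ?_
    unfold gammaCoeff
    linear_combination (-(a.1 f - a.1 f.kap) * betaCoeff b f) * hs f
  have h2 : ∑ f : BdFlag T, f.sgn * (gammaCoeff a f * gammaCoeff b f) = 0 :=
    sum_sgn_kap_eq_zero fun f => by rw [gammaCoeff_kap, gammaCoeff_kap]
  have h3 : ∑ f : BdFlag T, f.sgn * (betaCoeff a f * betaCoeff b f) = 0 :=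
    sum_sgn_eq_zero OrientedTriangulation.mu_mu OrientedTriangulation.sgn_mu _ fun f => by
      rw [betaCoeff_mu, betaCoeff_mu]
  have h4 : ∑ f : BdFlag T, f.sgn * (betaCoeff a (𝒯.cross f) * betaCoeff b f) = 0 :=
    sum_sgn_eq_zero OrientedTriangulation.mu_mu OrientedTriangulation.sgn_mu
      (fun f => betaCoeff a (𝒯.cross f) * betaCoeff b f) fun f => by
      rw [OrientedTriangulation.cross_mu, betaCoeff_mu, betaCoeff_mu]
  have h5 := sum_sgn_comp 𝒯.cross_cross 𝒯.sgn_cross fun f =>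
    gammaCoeff a (𝒯.cross f) * betaCoeff b f
  simp only [𝒯.cross_cross] at h5
  have h6 : crossPairing 𝒯 b a = ∑ f, f.sgn * (gammaCoeff a f * gammaCoeff b f)
      + ∑ f, f.sgn * (gammaCoeff a f * betaCoeff b f)
      - ∑ f, f.sgn * (gammaCoeff a f * betaCoeff b (𝒯.cross f)) := by
    rw [crossPairing, ← Finset.sum_add_distrib, ← Finset.sum_sub_distrib]
    refine Finset.sum_congr rfl fun f _ => ?_
    linear_combination f.sgn * gammaCoeff a f * coeff_cross 𝒯 hb f
  have h7 : ∑ f, f.sgn * (gammaCoeff a (𝒯.cross f) * betaCoeff b f) =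
      ∑ f, f.sgn * (gammaCoeff a f * betaCoeff b f)
      + ∑ f, f.sgn * (betaCoeff a f * betaCoeff b f)
      - ∑ f, f.sgn * (betaCoeff a (𝒯.cross f) * betaCoeff b f) := by
    rw [← Finset.sum_add_distrib, ← Finset.sum_sub_distrib]
    refine Finset.sum_congr rfl fun f _ => ?_
    linear_combination f.sgn * betaCoeff b f * coeff_cross 𝒯 ha f
  linarith

theorem facePairing_of_invariant (n : ℕ) (Φ : BdFlag T → ℕ → ℕ → ℕ → ℤ)
    {Ψ : BdFlag T → ℕ → ℕ → ℕ → ℤ} (hΨ : ∀ f, Ψ (𝒯.cross f) = Ψ f) :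
    facePairing n Φ (fun f x y z => Ψ f x y z - Ψ (𝒯.cross f) x y z) = 0 := by
  simp [facePairing, hΨ]

theorem facePairing_jump {n : ℕ} (Φ : BdFlag T → ℕ → ℕ → ℕ → ℤ) (hΦ : IsFaceFamily Φ)
    {a : LocalChain T} (ha : a ∈ 𝒯.cycles) (r : ℕ) :
    facePairing n Φ (fun f x y z => faceValue (cuspFunction n a r) f x y z
      - faceValue (cuspFunction n a r) (𝒯.cross f) x y z) =
    edgeSum n (coeffJump 𝒯 a) Φ r - edgeSum n (coeffJump 𝒯 a) Φ (r + 1) := by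
  rw [← facePairing_levelFamily n r (coeffJump_mu 𝒯 a) hΦ]
  exact facePairing_congr_right fun f x y z h => faceValue_cuspFunction_sub_cross 𝒯 ha r f h

/-! ### Values of the form on gluing and cusp weights -/

theorem pointForm_gluing_gluing {n : ℕ} (p q : 𝒯.NonVertexPoint n) :
    pointForm n (gluingFunction 𝒯 p) (gluingFunction 𝒯 q) = 0 := by
  have h := two_mul_facePairing 𝒯 n (isFaceFamily_faceValue (gluingFunction 𝒯 p))
    (isFaceFamily_faceValue (gluingFunction 𝒯 q))
  rw [facePairing_of_invariant 𝒯 n _ (faceValue_gluingFunction_cross 𝒯 q),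
    facePairing_of_invariant 𝒯 n _ (faceValue_gluingFunction_cross 𝒯 p)] at h
  rw [pointForm_eq_facePairing]
  linarith

theorem pointForm_gluing_cusp {n : ℕ} (p : 𝒯.NonVertexPoint n) {a : LocalChain T}
    (ha : a ∈ 𝒯.cycles) (r : ℕ) :
    pointForm n (gluingFunction 𝒯 p) (cuspFunction n a r) = 0 := by
  have h := two_mul_facePairing 𝒯 n (isFaceFamily_faceValue (gluingFunction 𝒯 p))
    (isFaceFamily_faceValue (cuspFunction n a r))
  rw [facePairing_jump 𝒯 _ (isFaceFamily_faceValue _) ha,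
    facePairing_of_invariant 𝒯 n _ (faceValue_gluingFunction_cross 𝒯 p),
    edgeSum_of_invariant 𝒯 n ha _ (faceValue_gluingFunction_cross 𝒯 p),
    edgeSum_of_invariant 𝒯 n ha _ (faceValue_gluingFunction_cross 𝒯 p)] at h
  rw [pointForm_eq_facePairing]
  linarith

theorem pointForm_cusp_cusp {n : ℕ} {a b : LocalChain T} (ha : a ∈ 𝒯.cycles)
    (hb : b ∈ 𝒯.cycles) (r s : Fin (n - 1)) :
    pointForm n (cuspFunction n a r) (cuspFunction n b s) =
      OrientedTriangulation.chainPairing a b * CartanMatrix.A (n - 1) r s := by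
  have h := two_mul_facePairing 𝒯 n (isFaceFamily_faceValue (cuspFunction n a r))
    (isFaceFamily_faceValue (cuspFunction n b s))
  have hr : r.1 + 2 ≤ n := by omega
  have hs : s.1 + 2 ≤ n := by omega
  -- Rewriting everything in terms of `crossPairing 𝒯 b a` and a single `crossRevPairing` makes the
  -- opposite-end terms, with indicators `r + s + 2 = n` and `r + s + 3 = n`, cancel.
  rw [facePairing_jump 𝒯 _ (isFaceFamily_faceValue _) ha,
    facePairing_jump 𝒯 _ (isFaceFamily_faceValue _) hb, edgeSum_cuspFunction 𝒯 hr hb,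
    edgeSum_cuspFunction 𝒯 hr hb, edgeSum_cuspFunction 𝒯 hs ha, edgeSum_cuspFunction 𝒯 hs ha,
    crossPairing_skew 𝒯 a b, crossRevPairing_symm 𝒯 a b, ← two_mul_chainPairing 𝒯 ha hb,
    add_comm r.1 s.1, show r.1 + 1 + s.1 = s.1 + 1 + r.1 by omega] at h
  have hA : CartanMatrix.A (n - 1) r s = 2 * (if s.1 = r.1 then 1 else 0)
      - (if s.1 + 1 = r.1 then 1 else 0) - (if r.1 + 1 = s.1 then 1 else 0) := by
    simp only [CartanMatrix.A, Matrix.of_apply, Fin.ext_iff]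
    split_ifs <;> omega
  rw [pointForm_eq_facePairing, hA]
  simp only [eq_comm (a := r.1) (b := s.1)] at h
  split_ifs at h ⊢ <;> omega

end

theorem mainTheorem2 {T : Type*} [Fintype T] [DecidableEq T] (𝒯 : OrientedTriangulation T)
    (n : ℕ) :
    (∀ p q : 𝒯.NonVertexPoint n,
      omegaJ (𝒯.gluingMatrix n p) (𝒯.gluingMatrix n q) = 0) ∧
    (∀ (p : 𝒯.NonVertexPoint n) (a : 𝒯.cycles) (r : Fin (n - 1)),
      omegaJ (𝒯.gluingMatrix n p) (𝒯.cuspMatrix n (a, r)) = 0) ∧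
    (∀ (α β : 𝒯.H1) (a b : 𝒯.cycles),
      Submodule.Quotient.mk a = α → Submodule.Quotient.mk b = β →
      ∀ r s : Fin (n - 1),
        omegaJ (𝒯.cuspMatrix n (a, r)) (𝒯.cuspMatrix n (b, s)) =
          -OrientedTriangulation.JGroup.Omega
            (OrientedTriangulation.deltaPrime a.1 r : OrientedTriangulation.JGroup T n)
            (OrientedTriangulation.deltaPrime b.1 s) ∧
        OrientedTriangulation.JGroup.Omega
            (OrientedTriangulation.deltaPrime a.1 r : OrientedTriangulation.JGroup T n)
            (OrientedTriangulation.deltaPrime b.1 s) =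
          𝒯.intersectionForm α β *
            ((Pi.single r 1 : Fin (n - 1) → ℤ) ⬝ᵥ (CartanMatrix.A (n - 1) *ᵥ Pi.single s 1))) := by
  have hg : ∀ p : 𝒯.NonVertexPoint n, 𝒯.gluingMatrix n p =
      Sum.elim (pointSum (n := n) expA (gluingFunction 𝒯 p))
        (pointSum expB (gluingFunction 𝒯 p)) := fun p => by
    rw [← gluingSum_eq_pointSum, ← gluingSum_eq_pointSum]; rfl
  have hc : ∀ (a : 𝒯.cycles) (r : Fin (n - 1)), 𝒯.cuspMatrix n (a, r) =
      Sum.elim (pointSum (n := n) expA (cuspFunction n a.1 r))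
        (pointSum expB (cuspFunction n a.1 r)) := fun a r => by
    rw [← cuspSum_eq_pointSum, ← cuspSum_eq_pointSum]; rfl
  refine ⟨fun p q => ?_, fun p a r => ?_, ?_⟩
  · rw [hg, hg, omegaJ_pointSum, pointForm_gluing_gluing, neg_zero]
  · rw [hg, hc, omegaJ_pointSum, pointForm_gluing_cusp 𝒯 p a.2, neg_zero]
  · rintro _ _ a b rfl rfl r s
    have hΩ : OrientedTriangulation.JGroup.Omega
        (OrientedTriangulation.deltaPrime a.1 r : OrientedTriangulation.JGroup T n)
        (OrientedTriangulation.deltaPrime b.1 s) =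
        pointForm n (cuspFunction n a.1 r) (cuspFunction n b.1 s) := by
      rw [← Omega_pointSum, ← cuspSum_eq_pointSum, ← cuspSum_eq_pointSum]; rfl
    refine ⟨?_, ?_⟩
    · rw [hc, hc, omegaJ_pointSum, hΩ]
    · rw [hΩ, pointForm_cusp_cusp 𝒯 a.2 b.2, 𝒯.intersectionForm_mk]
      simp

end
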